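/- Let $g_*$ be the standard round metric on $\mathbb{S}^2$ (area $4\pi$). For a sphere $\Sigma\cong\mathbb S^2$ with induced metric $g$, area measure $d\sigma$ and mean curvature $H$, the hyperbolic Hawking mass is $$\mathfrak m_H^{AH}(\Sigma)=\sqrt{\frac{|\Sigma|_g}{16\pi}}\Big(1-\frac1{16\pi}\int_\Sigma (H^2-4)\,d\sigma\Big).$$ For $m\in\mathbb R$ the spatial AdS-Schwarzschild manifold of mass $m$ is $(r_+,\infty)\times\mathbb S^2$ with the metric $\big(1+r^2-\frac{2m}{r}\big)^{-1}dr^2+r^2g_*$, where $r_+=r_+(m)$ is the largest root of $1+r^2-\frac{2m}r$ if $m>0$, and $r_+=0$ otherwise; for $m=0$ this is hyperbolic space in polar coordinates. A Riemannian $3$-manifold $(M,\gamma)$ is called asymptotically hyperbolic if there are a compact set $K\subset M$ and a diffeomorphism of $M\setminus K$ onto the complement $(R_0,\infty)\times\mathbb S^2$ ($R_0>0$) of a closed ball in hyperbolic space $(\mathbb H^3,g_{\mathbb H})$ such that the push-forward of $\gamma$ is $h=g_{\mathbb H}+e$ with $|e|_{g_{\mathbb H}}+|\nabla e|_{g_{\mathbb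 H}}=O(r^{-\tau})$ for some $\tau>\frac32$ ($\nabla$ is the Levi-Civita connection of $g_{\mathbb H}$), and $r\,(R(h)+6)$ is integrable for the hyperbolic volume. **Proposition.** Let $a<b$, let $f$ be a smooth positive function on $[a,b]$ with $f'(b)>0$, and let $\gamma_f=ds^2+f(s)^2g_*$ on $[a,b]\times\mathbb S^2$. Suppose that (i) $\gamma_f$ has scalar curvature $R(\gamma_f)>-6$; (ii) $\Sigma_b=\{b\}\times\mathbb S^2$ has positive mean curvature (with respect to the unit normal $\partial_s$); (iii) $\mathfrak m_H^{AH}(\Sigma_b)\ge -f(b)^3$. Then for every $m_e>\mathfrak m_H^{AH}(\Sigma_b)$ there is a smooth, rotationally symmetric ($O(3)$ acts by isometries), asymptotically hyperbolic Riemannian metric $\gamma$ with scalar curvature $R(\gamma)\ge-6$ on the manifold $M=[a,\infty)\times\mathbb S^2$ with inner boundary $\partial M=\{a\}\times\mathbb S^2$, such that (I) for some compact neighbourhood $K$ of $\partial M$ and some $r_0>r_+(m_e)$, $(M\setminus K,\gamma)$ is isometric to the region $(r_0,\infty)\times\mathbb S^2$ of the spatial AdS-Schwarzschild manifold of mass $m_e$;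 (II) some neighbourhood of $\partial M$ in $M$ is isometric to $\big([a,\frac{a+b}2]\times\mathbb S^2,\gamma_f\big)$, by an isometry that takes $\{a\}\times\mathbb S^2$ to $\partial M$. In addition, if $f'>0$ on $[a,b]$, then $(M,\gamma)$ is also foliated by mean convex CMC spheres: each slice $\{s\}\times\mathbb S^2$, $s\ge a$, has constant positive mean curvature with respect to the unit normal pointing to infinity. -/

import Mathlib

open Set Topology MeasureTheory
open scoped Manifold ContDiff

namespace WarpedGluing

noncomputable section

/-! ### Metric tensors, pullbacks, isometries -/

section General

variable {E : Type*} [NormedAddCommGroup E] [NormedSpace ℝ E]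
  {H : Type*} [TopologicalSpace H]
  {E' : Type*} [NormedAddCommGroup E'] [NormedSpace ℝ E']
  {H' : Type*} [TopologicalSpace H']

/-- A field of bilinear forms on the tangent spaces of a manifold `M` (a covariant 2-tensor). -/
abbrev Tensor2 (I : ModelWithCorners ℝ E H) (M : Type*) [TopologicalSpace M]
    [ChartedSpace H M] :=
  ∀ x : M, LinearMap.BilinForm ℝ (TangentSpace I x)

/-- The pullback `Φ^* g` of a covariant 2-tensor under a map `Φ` defined on the domain `D`. On a
domain with boundary the differential of `Φ` at boundary points is taken within `D`. -/
def pullbackWithin {I : ModelWithCorners ℝ E H} {I' : ModelWithCorners ℝ E' H'}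
    {M : Type*} [TopologicalSpace M] [ChartedSpace H M]
    {M' : Type*} [TopologicalSpace M'] [ChartedSpace H' M']
    (Φ : M → M') (D : Set M) (g : Tensor2 I' M') : Tensor2 I M :=
  fun x => LinearMap.compl₁₂ (g (Φ x))
    (mfderivWithin I I' Φ D x).toLinearMap (mfderivWithin I I' Φ D x).toLinearMap

/-- `Φ`, with inverse `Ψ`, is a smooth diffeomorphism of the domain `D` onto the domain `D'`. -/
structure IsDiffeo (I : ModelWithCorners ℝ E H) (I' : ModelWithCorners ℝ E' H')
    {M : Type*} [TopologicalSpace M] [ChartedSpace H M]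
    {M' : Type*} [TopologicalSpace M'] [ChartedSpace H' M']
    (D : Set M) (D' : Set M') (Φ : M → M') (Ψ : M' → M) : Prop where
  smooth : ContMDiffOn I I' ∞ Φ D
  smooth_inv : ContMDiffOn I' I ∞ Ψ D'
  mapsTo : MapsTo Φ D D'
  mapsTo_inv : MapsTo Ψ D' D
  left_inv : LeftInvOn Ψ Φ D
  right_inv : RightInvOn Ψ Φ D'

/-- `Φ` is an isometry of the Riemannian domain `(D, g)` onto the Riemannian domain `(D', g')`:
a diffeomorphism with `Φ^* g' = g` on `D`. -/
def IsIsometry {I : ModelWithCorners ℝ E H} {I' : ModelWithCorners ℝ E' H'}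
    {M : Type*} [TopologicalSpace M] [ChartedSpace H M]
    {M' : Type*} [TopologicalSpace M'] [ChartedSpace H' M']
    (g : Tensor2 I M) (D : Set M) (g' : Tensor2 I' M') (D' : Set M') (Φ : M → M') : Prop :=
  (∃ Ψ : M' → M, IsDiffeo I I' D D' Φ Ψ) ∧
    ∀ x ∈ D, pullbackWithin (I := I) Φ D g' x = g x

end General

/-! ### The sphere and the cylinder -/

/-- Euclidean 3-space. -/
abbrev E3 := EuclideanSpace ℝ (Fin 3)

/-- The unit sphere in Euclidean 3-space, with its standard smooth structure. -/
abbrev S2 := Metric.sphere (0 : E3) 1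

/-- The cylinder `ℝ × S²`. All 3-manifolds below are domains `J × S²` in it, with `J` an interval
that may contain its end points (these then give boundary spheres). -/
abbrev Cyl := ℝ × S2

/-- The product smooth structure of `ℝ × S²` is modelled on this (boundaryless) model. -/
abbrev cylModel := (𝓘(ℝ, ℝ)).prod (𝓡 2)

/-- The model vector space of the cylinder. -/
abbrev Coord := ℝ × EuclideanSpace ℝ (Fin 2)

/-- The constant Euclidean metric tensor of an inner product space. -/
def flat (V : Type*) [NormedAddCommGroup V] [InnerProductSpace ℝ V] : Tensor2 𝓘(ℝ, V) V :=
  fun _ => (innerₗ V : LinearMap.BilinForm ℝ V)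

/-- The standard round metric `g_*` of `S²`, induced by the inclusion into Euclidean space. -/
def roundMetric : Tensor2 (𝓡 2) S2 :=
  pullbackWithin (Subtype.val : S2 → E3) univ (flat E3)

/-- The metric `φ(s) ds² + f(s)² g_*` on the cylinder. -/
def warpedMetric (φ f : ℝ → ℝ) : Tensor2 cylModel Cyl := fun p =>
  φ p.1 • (pullbackWithin (Prod.fst : Cyl → ℝ) univ (flat ℝ) : Tensor2 cylModel Cyl) p +
    f p.1 ^ 2 • (pullbackWithin (Prod.snd : Cyl → S2) univ roundMetric : Tensor2 cylModel Cyl) p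

/-! ### Riemannian geometry of domains in the cylinder, in local coordinates -/

/-- The domain `D` in the preferred chart around `p`. -/
def chartDomain (D : Set Cyl) (p : Cyl) : Set Coord :=
  (extChartAt cylModel p).target ∩ (extChartAt cylModel p).symm ⁻¹' D

/-- The standard basis of the coordinate space. -/
def coordVec : Fin 3 → Coord :=
  ![(1, 0), (0, EuclideanSpace.single 0 1), (0, EuclideanSpace.single 1 1)]

/-- The matrix `g_ij` of the metric in the preferred chart around `p`. -/
def coordMetric (g : Tensor2 cylModel Cyl) (p : Cyl) (y : Coord) : Matrix (Fin 3) (Fin 3) ℝ :=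
  Matrix.of fun i j =>
    (pullbackWithin (extChartAt cylModel p).symm (extChartAt cylModel p).target g :
      Tensor2 𝓘(ℝ, Coord) Coord) y (coordVec i) (coordVec j)

/-- The partial derivative `∂_k h` on a coordinate domain `S`; at boundary points it is one-sided.
-/
def pd (S : Set Coord) (k : Fin 3) (h : Coord → ℝ) (y : Coord) : ℝ :=
  fderivWithin ℝ h S y (coordVec k)

/-- The Christoffel symbol `Γ^k_ij` of the coordinate metric `G`. -/
def christoffel (G : Coord → Matrix (Fin 3) (Fin 3) ℝ) (S : Set Coord) (k i j : Fin 3)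
    (y : Coord) : ℝ :=
  (1 / 2) * ∑ l, (G y)⁻¹ k l *
    (pd S i (fun z => G z j l) y + pd S j (fun z => G z i l) y - pd S l (fun z => G z i j) y)

/-- The Ricci tensor
`R_ij = ∂_k Γ^k_ij - ∂_j Γ^k_ik + Γ^k_kl Γ^l_ij - Γ^k_jl Γ^l_ik` (summed over `k`, `l`). -/
def coordRicci (G : Coord → Matrix (Fin 3) (Fin 3) ℝ) (S : Set Coord) (i j : Fin 3)
    (y : Coord) : ℝ :=
  ∑ k, (pd S k (christoffel G S k i j) y - pd S j (christoffel G S k i k) y) +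
    ∑ k, ∑ l, (christoffel G S k k l y * christoffel G S l i j y -
      christoffel G S k j l y * christoffel G S l i k y)

/-- The scalar curvature `R(g) = g^ij R_ij` of `(D, g)` at `p`. -/
def scalarCurvature (g : Tensor2 cylModel Cyl) (D : Set Cyl) (p : Cyl) : ℝ :=
  ∑ i, ∑ j, (coordMetric g p (extChartAt cylModel p p))⁻¹ i j *
    coordRicci (coordMetric g p) (chartDomain D p) i j (extChartAt cylModel p p)

/-- The components `∇^i ρ = g^ij ∂_j ρ` of the gradient of a function. -/
def coordGrad (G : Coord → Matrix (Fin 3) (Fin 3) ℝ) (S : Set Coord) (ρ : Coord → ℝ) (i : Fin 3)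
    (y : Coord) : ℝ :=
  ∑ j, (G y)⁻¹ i j * pd S j ρ y

/-- The components of the unit normal `ν = ∇ρ / |∇ρ|` to the level sets of a function. -/
def coordNormal (G : Coord → Matrix (Fin 3) (Fin 3) ℝ) (S : Set Coord) (ρ : Coord → ℝ) (i : Fin 3)
    (y : Coord) : ℝ :=
  coordGrad G S ρ i y / √(∑ k, pd S k ρ y * coordGrad G S ρ k y)

/-- The mean curvature at `p` of the level set of `ρ` through `p` in `(D, g)`, with respect to the
unit normal `ν = ∇ρ / |∇ρ|`: it is `div ν = ∂_i ν^i + Γ^i_ij ν^j`, the trace of `∇ν`. -/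
def levelMeanCurvature (g : Tensor2 cylModel Cyl) (D : Set Cyl) (ρ : Cyl → ℝ) (p : Cyl) : ℝ :=
  let G := coordMetric g p
  let S := chartDomain D p
  let y := extChartAt cylModel p p
  let ν := coordNormal G S (ρ ∘ (extChartAt cylModel p).symm)
  ∑ i, pd S i (ν i) y + ∑ i, ∑ j, christoffel G S i i j y * ν j y

/-- The mean curvature of the slice `{s} × S²` through `p = (s, θ)`, with respect to the unit
normal pointing in the direction of increasing `s`. -/
def sliceMeanCurvature (g : Tensor2 cylModel Cyl) (D : Set Cyl) (p : Cyl) : ℝ :=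
  levelMeanCurvature g D Prod.fst p

/-- `g` restricts to a smooth Riemannian metric on the domain `D`. -/
structure IsRiemannianOn (g : Tensor2 cylModel Cyl) (D : Set Cyl) : Prop where
  symm : ∀ p ∈ D, ∀ v w : TangentSpace cylModel p, g p v w = g p w v
  pos : ∀ p ∈ D, ∀ v : TangentSpace cylModel p, v ≠ 0 → 0 < g p v v
  smooth : ∀ p : Cyl, ∀ i j : Fin 3,
    ContDiffOn ℝ ∞ (fun y => coordMetric g p y i j) (chartDomain D p)

/-- The action on the cylinder of a linear isometry of Euclidean 3-space, by rotations and
reflections of the sphere factor. -/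
def rotate (A : E3 ≃ₗᵢ[ℝ] E3) (p : Cyl) : Cyl :=
  (p.1, ⟨A p.2, by simp⟩)

/-- Rotational symmetry of `(D, g)`: the orthogonal group `O(3)` acts by isometries. -/
def IsRotationallySymmetric (g : Tensor2 cylModel Cyl) (D : Set Cyl) : Prop :=
  ∀ A : E3 ≃ₗᵢ[ℝ] E3, IsIsometry g D g D (rotate A)

/-! ### Surface measure and hyperbolic Hawking mass -/

/-- The standard area measure of the unit sphere (of total mass `4π`). -/
def sphereMeasure : Measure S2 := (volume : Measure E3).toSphere

/-- The area density of a metric `h` on `S²` relative to the round metric `g_*`, namely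
`√(det h_ij / det (g_*)_ij)`; it does not depend on the basis of the tangent plane. -/
def areaDensity (h : Tensor2 (𝓡 2) S2) (θ : S2) : ℝ :=
  let e : Fin 2 → TangentSpace (𝓡 2) θ :=
    fun i => (EuclideanSpace.single i 1 : EuclideanSpace ℝ (Fin 2))
  √((Matrix.of fun i j => h θ (e i) (e j)).det /
    (Matrix.of fun i j => roundMetric θ (e i) (e j)).det)

/-- The area measure of a metric `h` on `S²`. -/
def areaMeasure (h : Tensor2 (𝓡 2) S2) : Measure S2 :=
  sphereMeasure.withDensity fun θ => ENNReal.ofReal (areaDensity h θ)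

/-- The hyperbolic Hawking mass
`√(|Σ| / 16π) (1 - (1 / 16π) ∫_Σ (H² - 4) dσ)` of a metric sphere with mean curvature `H`. -/
def hyperbolicHawkingMass (h : Tensor2 (𝓡 2) S2) (Hm : S2 → ℝ) : ℝ :=
  √((areaMeasure h).real univ / (16 * Real.pi)) *
    (1 - 1 / (16 * Real.pi) * ∫ θ, (Hm θ ^ 2 - 4) ∂(areaMeasure h))

/-- The hyperbolic Hawking mass of the slice `{s} × S²` in `(D, g)`. -/
def sliceHawkingMass (g : Tensor2 cylModel Cyl) (D : Set Cyl) (s : ℝ) : ℝ :=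
  hyperbolicHawkingMass (pullbackWithin (fun θ : S2 => ((s, θ) : Cyl)) univ g)
    (fun θ => sliceMeanCurvature g D (s, θ))

/-! ### AdS-Schwarzschild manifolds and asymptotically hyperbolic manifolds -/

/-- The spatial AdS-Schwarzschild metric `(1 + r² - 2m/r)⁻¹ dr² + r² g_*` of mass `m`. For `m = 0`
this is the hyperbolic metric in polar coordinates. -/
def adsMetric (m : ℝ) : Tensor2 cylModel Cyl :=
  warpedMetric (fun r => (1 + r ^ 2 - 2 * m / r)⁻¹) id

/-- The radius `r₊` such that the metric of mass `m` lives on `(r₊, ∞) × S²`: the largest root of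
`1 + r² - 2m/r` if `m > 0`, and `0` otherwise. -/
def horizonRadius (m : ℝ) : ℝ :=
  open Classical in
  if 0 < m then sSup {r : ℝ | 0 < r ∧ 1 + r ^ 2 - 2 * m / r = 0} else 0

/-- The components `∇_k e_ij = ∂_k e_ij - Γ^l_ki e_lj - Γ^l_kj e_il` of the covariant derivative
of the 2-tensor `e` with respect to the metric `B`, in coordinates. -/
def coordCovDeriv (B e : Coord → Matrix (Fin 3) (Fin 3) ℝ) (S : Set Coord) (k i j : Fin 3)
    (y : Coord) : ℝ :=
  pd S k (fun z => e z i j) y - ∑ l, christoffel B S l k i y * e y l j -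
    ∑ l, christoffel B S l k j y * e y i l

/-- The norm of a coordinate vector with respect to the metric `B` at `y`. -/
def coordNorm (B : Coord → Matrix (Fin 3) (Fin 3) ℝ) (y : Coord) (u : Fin 3 → ℝ) : ℝ :=
  √(∑ i, ∑ j, B y i j * u i * u j)

/-- The metric `h` on `(R₀, ∞) × S²` is asymptotic to the hyperbolic metric `b`: for some
`τ > 3/2` the error `e = h - b` satisfies `|e|_b + |∇e|_b = O(r^(-τ))` (covariant derivative of
`b`), and `r (R(h) + 6)` is integrable for the hyperbolic volume
`r² (1 + r²)^(-1/2) dr dσ_*`. -/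
def IsAsymptoticToHyperbolic (h : Tensor2 cylModel Cyl) (R₀ : ℝ) : Prop :=
  (∃ τ : ℝ, 3 / 2 < τ ∧ ∃ C : ℝ, ∀ p ∈ (Ioi R₀ ×ˢ univ : Set Cyl),
    let B := coordMetric (adsMetric 0) p
    let e := fun y => coordMetric h p y - B y
    let S := chartDomain (Ioi R₀ ×ˢ univ) p
    let y := extChartAt cylModel p p
    (∀ v w : Fin 3 → ℝ,
      |∑ i, ∑ j, e y i j * v i * w j| ≤ C * p.1 ^ (-τ) * coordNorm B y v * coordNorm B y w) ∧
    (∀ u v w : Fin 3 → ℝ,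
      |∑ k, ∑ i, ∑ j, coordCovDeriv B e S k i j y * u k * v i * w j| ≤
        C * p.1 ^ (-τ) * coordNorm B y u * coordNorm B y v * coordNorm B y w)) ∧
  IntegrableOn
    (fun p : Cyl => p.1 * (scalarCurvature h (Ioi R₀ ×ˢ univ) p + 6) * (p.1 ^ 2 / √(1 + p.1 ^ 2)))
    (Ioi R₀ ×ˢ univ) ((volume : Measure ℝ).prod sphereMeasure)

/-- `(M, γ)` is asymptotically hyperbolic: outside a compact set `K` it is diffeomorphic to the
complement of a closed ball in hyperbolic space (which in polar coordinates, with the area radius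
as radial coordinate, is `(R₀, ∞) × S²` with `R₀ > 0`), and the push-forward of `γ` is asymptotic
to the hyperbolic metric. -/
def IsAsymptoticallyHyperbolic (γ : Tensor2 cylModel Cyl) (M : Set Cyl) : Prop :=
  ∃ K ⊆ M, IsCompact K ∧ ∃ R₀ : ℝ, 0 < R₀ ∧ ∃ Φ Ψ : Cyl → Cyl,
    IsDiffeo cylModel cylModel (M \ K) (Ioi R₀ ×ˢ univ) Φ Ψ ∧
    IsAsymptoticToHyperbolic (pullbackWithin Ψ (Ioi R₀ ×ˢ univ) γ) R₀

end

end WarpedGluing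

open WarpedGluing

/-! Where the radius function `h` increases, a rotationally symmetric metric can be written `(h')² /
F ds² + h² g_*` with `F = 1 + h² - 2μ/h`, where `μ` is the Hawking mass of the slices. Its scalar
curvature is `-6 + 4μ' / (h² h')` (`warpedScalar_of_mass`): the second derivative of `h` drops out.
Hence `R ≥ -6` means exactly that `μ` is nondecreasing, and constant `μ` gives AdS-Schwarzschild.
Extending the collar thus reduces to extending two functions of one variable, subject to `h' > 0`,
`μ' ≥ 0` and `F > 0`.

Near `b` the collar has `f' > 0`, so it is of this form, with a mass `w` that increases because `R >
-6`. There is room for the mass `w(b)`, since `w(b) < (f + f³)/2` near `b`. The radius is bent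
upwards from `f` to a line `s + C` lying above `f`, and the mass from `w` to the constant `w(b)`.
Both transitions go from a lower function to a higher one through a decreasing cutoff, so
monotonicity survives, and a larger radius only helps `F > 0`. Once the radius is at least `2|m| +
1`, the mass is raised from `w(b)` to `m`, and from then on the metric is AdS-Schwarzschild. This is
`exists_radius_mass`; `exists_profile` turns it into a metric.

The rest links these functions to the geometry. In the chart centred at a point the sphere is seen
stereographically, so the metric is diagonal and its Christoffel symbols are radial factors times
spherical factors. This yields the scalar curvature, the mean curvature and the Hawking mass.
Comparing the mass `m` end with mass `0` gives decay of order `r⁻³`. -/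

namespace WarpedGluing

/-! ### The stereographic parametrization -/

section Stereo

variable {V W : Type*} [NormedAddCommGroup V] [InnerProductSpace ℝ V]
  [NormedAddCommGroup W] [InnerProductSpace ℝ W]

/-- The derivative of `w ↦ 1 / (‖w‖² + 4)`. -/
theorem hasFDerivAt_inv_norm_sq_add_four (w : V) :
    HasFDerivAt (fun w : V => (‖w‖ ^ 2 + 4)⁻¹)
      ((-2 * ((‖w‖ ^ 2 + 4)⁻¹) ^ 2) • innerSL ℝ w) w := by
  have h0 : ‖w‖ ^ 2 + 4 ≠ 0 := by positivity
  have h1 : HasFDerivAt (fun w : V => ‖w‖ ^ 2 + 4) (2 • innerSL ℝ w) w :=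
    (hasStrictFDerivAt_norm_sq w).hasFDerivAt.add_const 4
  have h2 := (hasDerivAt_inv h0).comp_hasFDerivAt w h1
  convert! h2 using 1
  ext v
  simp
  ring

/-- Inverse stereographic projection is conformal with factor `16 / (‖w‖² + 4)²`. -/
theorem exists_hasFDerivAt_stereo (X : V →ₗᵢ[ℝ] W) (n : W) (hn : ‖n‖ = 1)
    (hX : ∀ w, inner ℝ (X w) n = 0) (w : V) :
    ∃ L : V →L[ℝ] W,
      HasFDerivAt (fun w => (‖w‖ ^ 2 + 4)⁻¹ • ((4 : ℝ) • X w + (‖w‖ ^ 2 - 4) • n)) L w ∧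
      ∀ u v, inner ℝ (L u) (L v) = 16 / (‖w‖ ^ 2 + 4) ^ 2 * inner ℝ u v := by
  have hq := hasFDerivAt_inv_norm_sq_add_four w
  set q' : V →L[ℝ] ℝ := (-2 * ((‖w‖ ^ 2 + 4)⁻¹) ^ 2) • innerSL ℝ w with hq'
  -- With `q = 1 / (‖w‖² + 4)` both coefficients are affine in `q`, namely `4q` and `1 - 8q`, so
  -- only `q` has to be differentiated.
  have e : (fun w : V => (‖w‖ ^ 2 + 4)⁻¹ • ((4 : ℝ) • X w + (‖w‖ ^ 2 - 4) • n)) =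
      fun w => ((4 * (‖w‖ ^ 2 + 4)⁻¹) • X w + (1 - 8 * (‖w‖ ^ 2 + 4)⁻¹) • n) := by
    funext w
    have h0 : ‖w‖ ^ 2 + 4 ≠ 0 := by positivity
    rw [smul_add, smul_smul, smul_smul, mul_comm]
    congr 2
    field_simp
    ring
  rw [e]
  have hd := ((hq.const_mul 4).smul X.toContinuousLinearMap.hasFDerivAt).add
    (((hq.const_mul 8).const_sub 1).smul_const n)
  refine ⟨_, hd, fun u v => ?_⟩
  have hXX : ∀ a b, inner ℝ (X a) (X b) = inner ℝ a b := fun a b => X.inner_map_map a b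
  have hX' : ∀ w, inner ℝ n (X w) = 0 := fun w => by rw [real_inner_comm, hX]
  simp only [add_apply, smul_apply,
    ContinuousLinearMap.smulRight_apply, LinearIsometry.coe_toContinuousLinearMap,
    inner_add_left, inner_add_right, inner_smul_left, inner_smul_right, hXX, hX, hX',
    real_inner_self_eq_norm_sq, hn, hq', neg_apply, innerSL_apply_apply,
    smul_eq_mul, conj_trivial, real_inner_comm w u]
  have h0 : ‖w‖ ^ 2 + 4 ≠ 0 := by positivity
  field_simp
  ring

end Stereo

/-! ### Pullbacks of warped metrics -/

theorem fact_finrank_E3 : Fact (Module.finrank ℝ E3 = 2 + 1) :=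
  ⟨finrank_euclideanSpace_fin⟩

theorem mdifferentiable_coe_sphere : MDifferentiable (𝓡 2) 𝓘(ℝ, E3) (Subtype.val : S2 → E3) :=
  have := fact_finrank_E3
  (contMDiff_coe_sphere (m := 1)).mdifferentiable one_ne_zero

noncomputable section

variable {E H : Type*} [NormedAddCommGroup E] [NormedSpace ℝ E] [TopologicalSpace H]
    {I : ModelWithCorners ℝ E H} {N : Type*} [TopologicalSpace N] [ChartedSpace H N]

/-- The differential of the inclusion of the sphere. -/
def sphereIncl (θ : S2) : EuclideanSpace ℝ (Fin 2) →L[ℝ] E3 :=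
  mfderiv (𝓡 2) 𝓘(ℝ, E3) (Subtype.val : S2 → E3) θ

/-- The differential of a real function. -/
def realDeriv (I : ModelWithCorners ℝ E H) (ψ : N → ℝ) (D : Set N) (x : N) : E →L[ℝ] ℝ :=
  mfderivWithin I 𝓘(ℝ, ℝ) ψ D x

/-- The differential of a map to Euclidean space. -/
def vecDeriv (I : ModelWithCorners ℝ E H) (ψ : N → E3) (D : Set N) (x : N) : E →L[ℝ] E3 :=
  mfderivWithin I 𝓘(ℝ, E3) ψ D x

theorem roundMetric_apply (θ : S2) (v w : EuclideanSpace ℝ (Fin 2)) :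
    roundMetric θ v w = inner ℝ (sphereIncl θ v) (sphereIncl θ w) := by
  simp only [roundMetric, pullbackWithin, mfderivWithin_univ, flat]
  rfl

theorem warpedMetric_apply (φ f : ℝ → ℝ) (p : Cyl) (v w : Coord) :
    warpedMetric φ f p v w = φ p.1 * (v.1 * w.1) + f p.1 ^ 2 *
        inner ℝ (sphereIncl p.2 v.2) (sphereIncl p.2 w.2) := by
  have h1 : warpedMetric φ f p v w = φ p.1 * inner ℝ v.1 w.1 + f p.1 ^ 2 *
        roundMetric p.2 v.2 w.2 := by
    simp only [warpedMetric, pullbackWithin, mfderivWithin_univ, mfderiv_fst,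
      mfderiv_snd, flat]
    rfl
  rw [h1, roundMetric_apply]
  simp [mul_comm]

/-- The chain rule, with the sphere component regarded as a map into Euclidean space. Every
differential is then that of a vector-valued function, and no chart of the target sphere is needed.
-/
theorem pullbackWithin_warpedMetric_apply
    (φ f : ℝ → ℝ) (Ψ : N → Cyl) {D : Set N} {x : N}
    (hΨ : MDifferentiableWithinAt I cylModel Ψ D x) (hD : UniqueMDiffWithinAt I D x)
    (v w : E) :
    pullbackWithin (I := I) Ψ D (warpedMetric φ f) x v w =
      φ (Ψ x).1 * (realDeriv I (fun z => (Ψ z).1) D x v * realDeriv I (fun z => (Ψ z).1) D x w) +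
      f (Ψ x).1 ^ 2 * inner ℝ (vecDeriv I (fun z => ((Ψ z).2 : E3)) D x v)
        (vecDeriv I (fun z => ((Ψ z).2 : E3)) D x w) := by
  have h1 : mfderivWithin I 𝓘(ℝ, ℝ) (fun z => (Ψ z).1) D x =
      (mfderiv cylModel 𝓘(ℝ, ℝ) (Prod.fst : Cyl → ℝ) (Ψ x)).comp
        (mfderivWithin I cylModel Ψ D x) :=
    mfderiv_comp_mfderivWithin x mdifferentiableAt_fst hΨ hD
  have h2 : mfderivWithin I 𝓘(ℝ, E3) (fun z => ((Ψ z).2 : E3)) D x =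
      (mfderiv (𝓡 2) 𝓘(ℝ, E3) (Subtype.val : S2 → E3) (Ψ x).2).comp
      ((mfderiv cylModel (𝓡 2) (Prod.snd : Cyl → S2) (Ψ x)).comp
        (mfderivWithin I cylModel Ψ D x)) := by
    have h3 : mfderivWithin I (𝓡 2) (fun z => (Ψ z).2) D x = _ :=
      mfderiv_comp_mfderivWithin x mdifferentiableAt_snd hΨ hD
    rw [← h3]
    exact mfderiv_comp_mfderivWithin x (mdifferentiable_coe_sphere _)
      (mdifferentiableAt_snd.comp_mdifferentiableWithinAt x hΨ) hD
  rw [realDeriv, vecDeriv, h1, h2, mfderiv_fst, mfderiv_snd]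
  exact warpedMetric_apply φ f (Ψ x) _ _

/-! ### Charts of the cylinder -/

theorem extChartAt_cyl_symm_apply (p : Cyl) (y : Coord) :
    (extChartAt cylModel p).symm y = (y.1, (extChartAt (𝓡 2) p.2).symm y.2) := by
  rw [extChartAt_prod]
  rfl

theorem extChartAt_sphere_target (θ : S2) : (extChartAt (𝓡 2) θ).target = univ := by
  have := fact_finrank_E3
  simp [extChartAt, chartAt, ChartedSpace.chartAt]

theorem extChartAt_cyl_target (p : Cyl) : (extChartAt cylModel p).target = univ := by
  rw [extChartAt_prod, PartialEquiv.prod_target, extChartAt_sphere_target]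
  have h : (extChartAt 𝓘(ℝ, ℝ) p.1).target = univ := by
    rw [extChartAt_model_space_eq_id]
    rfl
  rw [h, univ_prod_univ]

/-- The preferred chart at `θ` projects from `-θ`, so it is centred at `θ`. Curvatures at `θ` are
therefore evaluated at the origin only, where the conformal factor is `1` with vanishing
differential. -/
theorem extChartAt_sphere_self (θ : S2) : extChartAt (𝓡 2) θ θ = 0 := by
  have := fact_finrank_E3
  have : (stereographic' 2 (-θ)) θ = 0 := by
    change (OrthonormalBasis.fromOrthogonalSpanSingleton 2
      (ne_zero_of_mem_unit_sphere (-θ))).repr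
        (stereographic (norm_eq_of_mem_sphere (-θ)) θ) = 0
    rw [stereographic_neg_apply]
    exact map_zero _
  simpa [extChartAt, chartAt, ChartedSpace.chartAt] using this

theorem extChartAt_cyl_self (p : Cyl) : extChartAt cylModel p p = (p.1, 0) := by
  rw [extChartAt_prod, ← extChartAt_sphere_self p.2]
  rfl

/-- Here `n = -θ` is the pole of the projection and `X` identifies the coordinate plane
isometrically with the orthogonal complement of `θ`. -/
theorem exists_extChartAt_sphere_symm (θ : S2) :
    ∃ X : EuclideanSpace ℝ (Fin 2) →ₗᵢ[ℝ] E3, ∃ n : E3, ‖n‖ = 1 ∧ (∀ w, inner ℝ (X w) n = 0) ∧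
      ∀ w, ((extChartAt (𝓡 2) θ).symm w : E3) =
        (‖w‖ ^ 2 + 4)⁻¹ • ((4 : ℝ) • X w + (‖w‖ ^ 2 - 4) • n) := by
  have := fact_finrank_E3
  let U : (Submodule.span ℝ {((-θ : S2) : E3)})ᗮ ≃ₗᵢ[ℝ] EuclideanSpace ℝ (Fin 2) :=
        (OrthonormalBasis.fromOrthogonalSpanSingleton 2 (ne_zero_of_mem_unit_sphere (-θ))).repr
  refine ⟨(Submodule.subtypeₗᵢ _).comp U.symm.toLinearIsometry, (-θ : S2), by simp, fun w => ?_,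
    fun w => ?_⟩
  · exact Submodule.mem_orthogonal_singleton_iff_inner_left.1 (U.symm w).2
  · have := stereographic'_symm_apply (n := 2) (-θ) w
    have h2 : ((extChartAt (𝓡 2) θ).symm w : E3) = (stereographic' 2 (-θ)).symm w := by
      simp [extChartAt, chartAt, ChartedSpace.chartAt]
    rw [h2, this, smul_add]
    have h3 : ‖((U.symm w : _) : E3)‖ = ‖w‖ := by
      rw [Submodule.norm_coe, U.symm.norm_map]
    simp only
    erw [h3]
    rfl

theorem exists_hasFDerivAt_extChartAt_sphere_symm (θ : S2) (w : EuclideanSpace ℝ (Fin 2)) :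
    ∃ L : EuclideanSpace ℝ (Fin 2) →L[ℝ] E3,
      HasFDerivAt (fun w => ((extChartAt (𝓡 2) θ).symm w : E3)) L w ∧
      ∀ u v, inner ℝ (L u) (L v) = 16 / (‖w‖ ^ 2 + 4) ^ 2 * inner ℝ u v := by
  obtain ⟨X, n, hn, hX, e⟩ := exists_extChartAt_sphere_symm θ
  simp only [e]
  exact exists_hasFDerivAt_stereo X n hn hX w

/-- The conformal factor of the round metric in stereographic coordinates. -/
def conf (w : EuclideanSpace ℝ (Fin 2)) : ℝ := 16 / (‖w‖ ^ 2 + 4) ^ 2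

theorem conf_pos (w : EuclideanSpace ℝ (Fin 2)) : 0 < conf w := by
  unfold conf; positivity

theorem mdifferentiableWithinAt_extChartAt_cyl_symm (p : Cyl) (y : Coord) :
    MDifferentiableWithinAt 𝓘(ℝ, Coord) cylModel (extChartAt cylModel p).symm
      (extChartAt cylModel p).target y := by
  have h := contMDiffOn_extChartAt_symm (I := cylModel) (n := 1) p
  exact (h y (by rw [extChartAt_cyl_target]; trivial)).mdifferentiableWithinAt one_ne_zero

theorem pullbackWithin_extChartAt_symm_warpedMetric (φ f : ℝ → ℝ) (p : Cyl) (y v w : Coord) :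
    pullbackWithin (I := 𝓘(ℝ, Coord)) (extChartAt cylModel p).symm (extChartAt cylModel p).target
      (warpedMetric φ f) y v w =
      φ y.1 * (v.1 * w.1) + f y.1 ^ 2 * (conf y.2 * inner ℝ v.2 w.2) := by
  have hd := mdifferentiableWithinAt_extChartAt_cyl_symm p y
  rw [extChartAt_cyl_target] at hd ⊢
  rw [pullbackWithin_warpedMetric_apply φ f _ hd (uniqueMDiffWithinAt_univ _)]
  obtain ⟨L, hL, hLi⟩ := exists_hasFDerivAt_extChartAt_sphere_symm p.2 y.2
  have h1 : realDeriv 𝓘(ℝ, Coord) (fun z => ((extChartAt cylModel p).symm z).1) univ y =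
      ContinuousLinearMap.fst ℝ ℝ (EuclideanSpace ℝ (Fin 2)) := by
    rw [realDeriv, mfderivWithin_eq_fderivWithin, fderivWithin_univ]
    simp only [extChartAt_cyl_symm_apply]
    exact hasFDerivAt_fst.fderiv
  have h2 : vecDeriv 𝓘(ℝ, Coord) (fun z => (((extChartAt cylModel p).symm z).2 : E3)) univ y =
      L.comp (ContinuousLinearMap.snd ℝ ℝ (EuclideanSpace ℝ (Fin 2))) := by
    rw [vecDeriv, mfderivWithin_eq_fderivWithin, fderivWithin_univ]
    simp only [extChartAt_cyl_symm_apply]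
    exact (hL.comp y hasFDerivAt_snd).fderiv
  rw [h1, h2]
  simp only [ContinuousLinearMap.coe_fst', ContinuousLinearMap.comp_apply,
    ContinuousLinearMap.coe_snd', hLi, conf, extChartAt_cyl_symm_apply]

theorem coordMetric_warpedMetric (φ f : ℝ → ℝ) (p : Cyl) (y : Coord) :
    coordMetric (warpedMetric φ f) p y =
      Matrix.diagonal ![φ y.1, f y.1 ^ 2 * conf y.2, f y.1 ^ 2 * conf y.2] := by
  ext i j
  simp only [coordMetric, Matrix.of_apply, pullbackWithin_extChartAt_symm_warpedMetric]
  fin_cases i <;> fin_cases j <;> simp [coordVec, EuclideanSpace.inner_single_left]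

theorem coordMetric_congr {g g' : Tensor2 cylModel Cyl} {D : Set Cyl}
    (h : ∀ p ∈ D, g p = g' p) (p : Cyl) {y : Coord} (hy : y ∈ chartDomain D p) :
    coordMetric g p y = coordMetric g' p y := by
  ext i j
  simp only [coordMetric, Matrix.of_apply, pullbackWithin, h _ hy.2]

theorem chartDomain_prod (J : Set ℝ) (p : Cyl) :
    chartDomain (J ×ˢ univ) p = J ×ˢ univ := by
  ext y
  rw [chartDomain, extChartAt_cyl_target, univ_inter, mem_preimage, extChartAt_cyl_symm_apply]
  rfl

theorem sphereIncl_injective (θ : S2) : Function.Injective (sphereIncl θ) := by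
  have := fact_finrank_E3
  exact injective_mvfderiv_subtypeVal_sphere (n := 2) θ

end

end WarpedGluing

namespace WarpedGluing

noncomputable section

/-! ### Coordinate calculus on product domains -/

theorem pd_congr {S : Set Coord} {u v : Coord → ℝ} {y : Coord} (h : ∀ z ∈ S, u z = v z)
    (hy : y ∈ S) (k : Fin 3) : pd S k u y = pd S k v y := by
  rw [pd, pd, fderivWithin_congr h (h y hy)]

/-- All functions differentiated below separate into a radial and a spherical factor. Only the
radial derivative can be one-sided, and unique differentiability of `J` makes it well defined. -/
theorem pd_mul_apply {J : Set ℝ} (hJ : UniqueDiffOn ℝ J) {A : ℝ → ℝ}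
    {B : EuclideanSpace ℝ (Fin 2) → ℝ} {A' : ℝ} {B' : EuclideanSpace ℝ (Fin 2) →L[ℝ] ℝ}
    {y : Coord} (hy : y.1 ∈ J) (hA : HasDerivWithinAt A A' J y.1) (hB : HasFDerivAt B B' y.2)
    (k : Fin 3) :
    pd (J ×ˢ univ) k (fun z => A z.1 * B z.2) y =
      A' * (coordVec k).1 * B y.2 + A y.1 * B' (coordVec k).2 := by
  have h1 : HasFDerivWithinAt (fun z : Coord => A z.1) _ (J ×ˢ univ) y :=
    hA.hasFDerivWithinAt.comp y hasFDerivWithinAt_fst (fun z hz => hz.1)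
  have h2 : HasFDerivWithinAt (fun z : Coord => B z.2) _ (J ×ˢ univ) y :=
    (hB.comp y hasFDerivAt_snd).hasFDerivWithinAt
  have h3 : HasFDerivWithinAt (fun z : Coord => A z.1 * B z.2) _ (J ×ˢ univ) y := h1.mul h2
  have hu : UniqueDiffWithinAt ℝ (J ×ˢ (univ : Set (EuclideanSpace ℝ (Fin 2)))) y :=
    (hJ y.1 hy).prod uniqueDiffWithinAt_univ
  rw [pd, h3.fderivWithin hu]
  simp
  ring

/-- The logarithmic derivative of `√conf`. -/
def confLog (i : Fin 2) (w : EuclideanSpace ℝ (Fin 2)) : ℝ := -2 * w i / (‖w‖ ^ 2 + 4)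

theorem hasFDerivAt_conf (w : EuclideanSpace ℝ (Fin 2)) :
    HasFDerivAt conf ((2 * conf w) • (confLog 0 w • EuclideanSpace.proj (𝕜 := ℝ) (0 : Fin 2) +
      confLog 1 w • EuclideanSpace.proj (𝕜 := ℝ) (1 : Fin 2))) w := by
  have h : HasFDerivAt (fun w : EuclideanSpace ℝ (Fin 2) => 16 * (‖w‖ ^ 2 + 4)⁻¹ ^ 2) _ w :=
    ((hasFDerivAt_inv_norm_sq_add_four w).pow 2).const_mul 16
  have h0 : ‖w‖ ^ 2 + 4 ≠ 0 := by positivity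
  have e : conf = fun w => 16 * (‖w‖ ^ 2 + 4)⁻¹ ^ 2 := by
    funext w; simp [conf, div_eq_mul_inv]
  rw [e]
  convert! h using 1
  · ext v
    simp [ confLog, PiLp.inner_apply, Fin.sum_univ_two]
    field_simp
    ring

theorem hasFDerivAt_confLog_zero (i : Fin 2) :
    HasFDerivAt (confLog i) ((-(1 / 2) : ℝ) • EuclideanSpace.proj (𝕜 := ℝ) i) 0 := by
  have h := (((EuclideanSpace.proj (𝕜 := ℝ) i).hasFDerivAt
    (x := (0 : EuclideanSpace ℝ (Fin 2)))).const_mul (-2)).mul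
      (hasFDerivAt_inv_norm_sq_add_four (0 : EuclideanSpace ℝ (Fin 2)))
  convert! h using 1
  ext v
  simp
  ring

theorem hasFDerivAt_conf_zero :
    HasFDerivAt conf (0 : EuclideanSpace ℝ (Fin 2) →L[ℝ] ℝ) 0 := by
  have h := hasFDerivAt_conf 0
  have e : (confLog 0 0 • EuclideanSpace.proj (𝕜 := ℝ) (0 : Fin 2) + confLog 1 0 •
      EuclideanSpace.proj (𝕜 := ℝ) (1 : Fin 2) : EuclideanSpace ℝ (Fin 2) →L[ℝ] ℝ) = 0 := by
    simp [confLog]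
  rwa [e, smul_zero] at h

theorem conf_zero : conf 0 = 1 := by norm_num [conf]

theorem confLog_zero (i : Fin 2) : confLog i 0 = 0 := by simp [confLog]

/-! ### Christoffel symbols of warped metrics -/

theorem inv_diagonal_three {a b c : ℝ} (ha : a ≠ 0) (hb : b ≠ 0) (hc : c ≠ 0) :
    (Matrix.diagonal ![a, b, c])⁻¹ = Matrix.diagonal ![a⁻¹, b⁻¹, c⁻¹] := by
  apply Matrix.inv_eq_right_inv
  rw [Matrix.diagonal_mul_diagonal, ← Matrix.diagonal_one]
  congr 1
  funext i
  fin_cases i <;> simp [ha, hb, hc]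

/-- The coordinate matrix of `φ ds² + h² g_*`. -/
def warpedMatrix (φ h : ℝ → ℝ) (y : Coord) : Matrix (Fin 3) (Fin 3) ℝ :=
  Matrix.diagonal ![φ y.1, h y.1 ^ 2 * conf y.2, h y.1 ^ 2 * conf y.2]

/-- The radial factors of the Christoffel symbols of a warped metric. -/
def chrRad (α β q : ℝ) : Fin 3 → Fin 3 → Fin 3 → ℝ :=
  ![![![α, 0, 0], ![0, β, 0], ![0, 0, β]],
    ![![0, q, 0], ![q, 1, 1], ![0, 1, 1]],
    ![![0, 0, q], ![0, 1, 1], ![q, 1, 1]]]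

/-- The spherical factors of the Christoffel symbols of a warped metric. -/
def chrSph (w : EuclideanSpace ℝ (Fin 2)) : Fin 3 → Fin 3 → Fin 3 → ℝ :=
  ![![![1, 0, 0], ![0, conf w, 0], ![0, 0, conf w]],
    ![![0, 1, 0], ![1, confLog 0 w, confLog 1 w], ![0, confLog 1 w, -confLog 0 w]],
    ![![0, 0, 1], ![0, -confLog 1 w, confLog 0 w], ![1, confLog 0 w, confLog 1 w]]]

theorem pd_warpedMatrix {J : Set ℝ} (hJ : UniqueDiffOn ℝ J) {φ h : ℝ → ℝ} {φ' h' : ℝ} {y : Coord}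
    (hy : y.1 ∈ J) (hφ : HasDerivWithinAt φ φ' J y.1) (hh : HasDerivWithinAt h h' J y.1)
    (k i j : Fin 3) :
    pd (J ×ˢ univ) k (fun z => warpedMatrix φ h z i j) y =
      (![Matrix.diagonal ![φ', 2 * h y.1 * h' * conf y.2, 2 * h y.1 * h' * conf y.2],
        Matrix.diagonal ![0, 2 * h y.1 ^ 2 * conf y.2 * confLog 0 y.2,
          2 * h y.1 ^ 2 * conf y.2 * confLog 0 y.2],
        Matrix.diagonal ![0, 2 * h y.1 ^ 2 * conf y.2 * confLog 1 y.2,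
          2 * h y.1 ^ 2 * conf y.2 * confLog 1 y.2]] : Fin 3 → Matrix (Fin 3) (Fin 3) ℝ) k i j := by
  by_cases hij : i = j
  · subst hij
    have h0 : i = 0 ∨ i ≠ 0 := em _
    rcases h0 with rfl | h0
    · have e := pd_mul_apply hJ hy hφ (hasFDerivAt_const (1 : ℝ) y.2) k
      have e2 : (fun z : Coord => warpedMatrix φ h z 0 0) = fun z => φ z.1 * 1 := by
        funext z; simp [warpedMatrix]
      rw [e2, e]
      fin_cases k <;> simp [coordVec]
    · have e := pd_mul_apply hJ hy (hh.pow 2) (hasFDerivAt_conf y.2) k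
      have e2 : (fun z : Coord => warpedMatrix φ h z i i) = fun z => (h ^ 2) z.1 * conf z.2 := by
        funext z; fin_cases i <;> simp_all [warpedMatrix]
      rw [e2, e]
      fin_cases i
      · exact absurd rfl h0
      all_goals
        fin_cases k <;> simp [coordVec] <;> ring
  · have e2 : (fun z : Coord => warpedMatrix φ h z i j) = fun z => 0 := by
      funext z; exact Matrix.diagonal_apply_ne _ hij
    rw [e2]
    have : pd (J ×ˢ univ) k (fun _ => 0) y = 0 := by simp [pd]
    rw [this]
    fin_cases k <;> simp [Matrix.diagonal_apply_ne _ hij]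

/-- The separated form holds on the whole coordinate domain, not just at the centre, because the
symbols are differentiated once more for the Ricci tensor. -/
theorem christoffel_warped {J : Set ℝ} (hJ : UniqueDiffOn ℝ J)
    {G : Coord → Matrix (Fin 3) (Fin 3) ℝ} {φ h : ℝ → ℝ} {φ' h' : ℝ}
    (hG : ∀ z ∈ (J ×ˢ univ : Set Coord), G z = warpedMatrix φ h z) {y : Coord} (hy : y.1 ∈ J)
    (hφ0 : φ y.1 ≠ 0) (hh0 : h y.1 ≠ 0)
    (hφ : HasDerivWithinAt φ φ' J y.1) (hh : HasDerivWithinAt h h' J y.1) (k i j : Fin 3) :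
    christoffel G (J ×ˢ univ) k i j y =
      chrRad (φ' / (2 * φ y.1)) (-(h y.1 * h' / φ y.1)) (h' / h y.1) k i j * chrSph y.2 k i j := by
  have hy' : y ∈ (J ×ˢ univ : Set Coord) := ⟨hy, trivial⟩
  have hc := (conf_pos y.2).ne'
  have e : ∀ k i j, pd (J ×ˢ univ) k (fun z => G z i j) y = _ := fun k i j =>
    (pd_congr (fun z hz => by rw [hG z hz]) hy' k).trans (pd_warpedMatrix hJ hy hφ hh k i j)
  simp only [christoffel, e, hG y hy', Fin.sum_univ_three]
  rw [warpedMatrix, inv_diagonal_three hφ0 (by positivity) (by positivity)]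
  fin_cases k <;> fin_cases i <;> fin_cases j <;> simp [chrRad, chrSph] <;> field_simp

/-- The derivatives of the radial factors `chrRad`. -/
def chrRadDeriv (α' β' q' : ℝ) : Fin 3 → Fin 3 → Fin 3 → ℝ :=
  ![![![α', 0, 0], ![0, β', 0], ![0, 0, β']],
    ![![0, q', 0], ![q', 0, 0], ![0, 0, 0]],
    ![![0, 0, q'], ![0, 0, 0], ![q', 0, 0]]]

theorem hasDerivWithinAt_chrRad {J : Set ℝ} {α β q : ℝ → ℝ} {α' β' q' s : ℝ}
    (hα : HasDerivWithinAt α α' J s) (hβ : HasDerivWithinAt β β' J s)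
    (hq : HasDerivWithinAt q q' J s) (k i j : Fin 3) :
    HasDerivWithinAt (fun s => chrRad (α s) (β s) (q s) k i j) (chrRadDeriv α' β' q' k i j) J s := by
  have h0 := hasDerivWithinAt_const s J (0 : ℝ)
  have h1 := hasDerivWithinAt_const s J (1 : ℝ)
  fin_cases k <;> fin_cases i <;> fin_cases j <;>
    first | exact h0 | exact h1 | exact hα | exact hβ | exact hq

/-- The derivatives of the spherical factors `chrSph` at the origin. -/
def chrSphDeriv (v : EuclideanSpace ℝ (Fin 2)) : Fin 3 → Fin 3 → Fin 3 → ℝ :=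
  ![![![0, 0, 0], ![0, 0, 0], ![0, 0, 0]],
    ![![0, 0, 0], ![0, -(v 0) / 2, -(v 1) / 2], ![0, -(v 1) / 2, v 0 / 2]],
    ![![0, 0, 0], ![0, v 1 / 2, -(v 0) / 2], ![0, -(v 0) / 2, -(v 1) / 2]]]

theorem exists_hasFDerivAt_chrSph (k i j : Fin 3) :
    ∃ B' : EuclideanSpace ℝ (Fin 2) →L[ℝ] ℝ, HasFDerivAt (fun w => chrSph w k i j) B' 0 ∧
      ∀ v, B' v = chrSphDeriv v k i j := by
  have h0 := hasFDerivAt_const (𝕜 := ℝ) (0 : ℝ) (0 : EuclideanSpace ℝ (Fin 2))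
  have h1 := hasFDerivAt_const (𝕜 := ℝ) (1 : ℝ) (0 : EuclideanSpace ℝ (Fin 2))
  have hc := hasFDerivAt_conf_zero
  have hl := hasFDerivAt_confLog_zero
  fin_cases k <;> fin_cases i <;> fin_cases j <;>
    first
    | exact ⟨_, h0, fun v => rfl⟩
    | exact ⟨_, h1, fun v => rfl⟩
    | exact ⟨_, hc, fun v => rfl⟩
    | exact ⟨_, hl 0, fun v => by simp [chrSphDeriv]; ring⟩
    | exact ⟨_, hl 1, fun v => by simp [chrSphDeriv]; ring⟩
    | exact ⟨_, (hl 0).neg, fun v => by simp [chrSphDeriv]; ring⟩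
    | exact ⟨_, (hl 1).neg, fun v => by simp [chrSphDeriv]; ring⟩

/-! ### The Ricci tensor at the centre of the chart -/

section Ricci

variable {J : Set ℝ} (hJ : UniqueDiffOn ℝ J) {G : Coord → Matrix (Fin 3) (Fin 3) ℝ}
  {α β q : ℝ → ℝ}
  (hΓ : ∀ z ∈ (J ×ˢ univ : Set Coord), ∀ k i j, christoffel G (J ×ˢ univ) k i j z =
    chrRad (α z.1) (β z.1) (q z.1) k i j * chrSph z.2 k i j)
  {s α' β' q' : ℝ} (hs : s ∈ J) (hα : HasDerivWithinAt α α' J s)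
  (hβ : HasDerivWithinAt β β' J s) (hq : HasDerivWithinAt q q' J s)
include hJ hΓ hs hα hβ hq

theorem pd_christoffel_warped (l k i j : Fin 3) :
    pd (J ×ˢ univ) l (christoffel G (J ×ˢ univ) k i j) (s, 0) =
      chrRadDeriv α' β' q' k i j * (coordVec l).1 * chrSph 0 k i j +
        chrRad (α s) (β s) (q s) k i j * chrSphDeriv (coordVec l).2 k i j := by
  obtain ⟨B', hB', e⟩ := exists_hasFDerivAt_chrSph k i j
  rw [pd_congr (fun z hz => hΓ z hz k i j) ⟨hs, trivial⟩]
  rw [pd_mul_apply hJ (y := (s, 0)) hs (hasDerivWithinAt_chrRad hα hβ hq k i j) hB', e]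

theorem coordRicci_warped_zero :
    coordRicci G (J ×ˢ univ) 0 0 (s, 0) = -2 * q' + 2 * α s * q s - 2 * q s ^ 2 := by
  have e := hΓ (s, 0) ⟨hs, trivial⟩
  simp only [coordRicci, pd_christoffel_warped hJ hΓ hs hα hβ hq, e, Fin.sum_univ_three]
  simp [chrRad, chrSph, chrRadDeriv, chrSphDeriv, coordVec, conf_zero, confLog_zero]
  ring

/-- The summand `1` is the Ricci curvature of the unit sphere, produced by the derivatives of
`confLog` at the origin. The products `β q` cancel. -/
theorem coordRicci_warped_ne_zero {i : Fin 3} (hi : i ≠ 0) :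
    coordRicci G (J ×ˢ univ) i i (s, 0) = β' + α s * β s + 1 := by
  have e := hΓ (s, 0) ⟨hs, trivial⟩
  simp only [coordRicci, pd_christoffel_warped hJ hΓ hs hα hβ hq, e, Fin.sum_univ_three]
  fin_cases i
  · exact absurd rfl hi
  all_goals
    simp [chrRad, chrSph, chrRadDeriv, chrSphDeriv, coordVec, conf_zero, confLog_zero]
    ring

end Ricci

end

end WarpedGluing

namespace WarpedGluing

noncomputable section

/-! ### Scalar curvature and mean curvature of warped metrics -/

/-- The scalar curvature of `φ ds² + h² g_*` in terms of the derivatives of `φ` and `h`. -/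
def warpedScalar (φ φ' h h' h'' : ℝ) : ℝ :=
  2 / h ^ 2 - 2 * h' ^ 2 / (φ * h ^ 2) - 4 * h'' / (φ * h) + 2 * h' * φ' / (φ ^ 2 * h)

section Curvature

variable {J : Set ℝ} (hJ : UniqueDiffOn ℝ J) {φ φ' h h' : ℝ → ℝ}
  (hφ0 : ∀ s ∈ J, 0 < φ s) (hh0 : ∀ s ∈ J, 0 < h s)
  (hφ : ∀ s ∈ J, HasDerivWithinAt φ (φ' s) J s) (hh : ∀ s ∈ J, HasDerivWithinAt h (h' s) J s)
  {g : Tensor2 cylModel Cyl} (hg : ∀ p ∈ (J ×ˢ univ : Set Cyl), g p = warpedMetric φ h p)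
include hg

theorem coordMetric_of_eq_warpedMetric (p : Cyl) :
    ∀ z ∈ (J ×ˢ univ : Set Coord), coordMetric g p z = warpedMatrix φ h z := by
  intro z hz
  rw [coordMetric_congr hg p (by rwa [chartDomain_prod]), coordMetric_warpedMetric, warpedMatrix]

include hJ hφ0 hh0 hφ hh

theorem christoffel_of_eq_warpedMetric (p : Cyl) :
    ∀ z ∈ (J ×ˢ univ : Set Coord), ∀ k i j, christoffel (coordMetric g p) (J ×ˢ univ) k i j z =
      chrRad (φ' z.1 / (2 * φ z.1)) (-(h z.1 * h' z.1 / φ z.1)) (h' z.1 / h z.1) k i j *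
        chrSph z.2 k i j := fun _ hz k i j =>
  christoffel_warped hJ (coordMetric_of_eq_warpedMetric hg p) hz.1 (hφ0 _ hz.1).ne' (hh0 _ hz.1).ne'
    (hφ _ hz.1) (hh _ hz.1) k i j

/-- The trace of the diagonal Ricci components at the chart centre. Agreement of `g` with the warped
metric is asked only on the domain, so that push-forwards to an end, which are arbitrary elsewhere,
are covered too. -/
theorem scalarCurvature_warped {p : Cyl} (hp : p.1 ∈ J) {φ'' h'' : ℝ}
    (hφ' : HasDerivWithinAt φ' φ'' J p.1) (hh' : HasDerivWithinAt h' h'' J p.1) :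
    scalarCurvature g (J ×ˢ univ) p = warpedScalar (φ p.1) (φ' p.1) (h p.1) (h' p.1) h'' := by
  have hφn := (hφ0 _ hp).ne'
  have hhn := (hh0 _ hp).ne'
  have hΓ := christoffel_of_eq_warpedMetric hJ hφ0 hh0 hφ hh hg p
  have hα := hφ'.div ((hφ _ hp).const_mul 2) (mul_ne_zero two_ne_zero hφn)
  have hβ := (((hh _ hp).mul hh').div (hφ _ hp) hφn).neg
  have hq := hh'.div (hh _ hp) hhn
  have hG : coordMetric g p (p.1, 0) = warpedMatrix φ h (p.1, 0) :=
    coordMetric_of_eq_warpedMetric hg p _ ⟨hp, trivial⟩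
  have r0 := coordRicci_warped_zero hJ hΓ hp hα hβ hq
  have r1 := coordRicci_warped_ne_zero hJ hΓ hp hα hβ hq (i := 1) (by decide)
  have r2 := coordRicci_warped_ne_zero hJ hΓ hp hα hβ hq (i := 2) (by decide)
  rw [scalarCurvature, extChartAt_cyl_self, chartDomain_prod, hG]
  simp only [warpedMatrix, conf_zero, mul_one]
  rw [inv_diagonal_three hφn (pow_ne_zero 2 hhn) (pow_ne_zero 2 hhn)]
  simp only [Fin.sum_univ_three, r0, r1, r2]
  simp [Pi.mul_apply, warpedScalar]
  field_simp
  ring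

/-- The unit normal is `φ^(-1/2) ∂_s`. In its divergence the derivative of `φ^(-1/2)` cancels
against `Γ^0_00`, and the two sphere directions contribute `h'/h` each. -/
theorem sliceMeanCurvature_warped {p : Cyl} (hp : p.1 ∈ J) :
    sliceMeanCurvature g (J ×ˢ univ) p = 2 * h' p.1 / (h p.1 * √(φ p.1)) := by
  have hφn := (hφ0 _ hp).ne'
  have hhn := (hh0 _ hp).ne'
  have hΓ := christoffel_of_eq_warpedMetric hJ hφ0 hh0 hφ hh hg p
  have hG := coordMetric_of_eq_warpedMetric hg p
  have hρ : (Prod.fst ∘ (extChartAt cylModel p).symm : Coord → ℝ) = Prod.fst := by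
    funext y
    rw [Function.comp_apply, extChartAt_cyl_symm_apply]
  have hpd : ∀ z ∈ (J ×ˢ univ : Set Coord), ∀ k,
      pd (J ×ˢ univ) k (Prod.fst : Coord → ℝ) z = (coordVec k).1 := by
    intro z hz k
    have h1 := pd_mul_apply hJ hz.1 (hasDerivWithinAt_id z.1 J)
      (hasFDerivAt_const (𝕜 := ℝ) (1 : ℝ) z.2) k
    simpa using h1
  have hν : ∀ z ∈ (J ×ˢ univ : Set Coord), ∀ i,
      coordNormal (coordMetric g p) (J ×ˢ univ) Prod.fst i z =
        (√(φ z.1))⁻¹ * (![1, 0, 0] : Fin 3 → ℝ) i := by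
    intro z hz i
    have hc := (conf_pos z.2).ne'
    have h0 := hφ0 _ hz.1
    have h1 := (hh0 _ hz.1).ne'
    simp only [coordNormal, coordGrad, hpd z hz, hG z hz, Fin.sum_univ_three, warpedMatrix]
    rw [inv_diagonal_three h0.ne' (by positivity) (by positivity)]
    have hs : √(φ z.1) ≠ 0 := (Real.sqrt_pos.2 h0).ne'
    fin_cases i <;> simp [coordVec]
    field_simp
    exact Real.sq_sqrt h0.le
  have hsq := (((hφ _ hp).sqrt hφn).inv (Real.sqrt_pos.2 (hφ0 _ hp)).ne')
  have hy : ((p.1, 0) : Coord) ∈ (J ×ˢ univ : Set Coord) := ⟨hp, trivial⟩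
  rw [sliceMeanCurvature, levelMeanCurvature]
  simp only [hρ, extChartAt_cyl_self, chartDomain_prod]
  have hpν : ∀ i, pd (J ×ˢ univ) i (coordNormal (coordMetric g p) (J ×ˢ univ) Prod.fst i)
      (p.1, 0) = _ := fun i =>
    (pd_congr (fun z hz => hν z hz i) hy i).trans
      (pd_mul_apply hJ (y := (p.1, 0)) hp hsq (hasFDerivAt_const (𝕜 := ℝ) _ _) i)
  simp only [hpν, hν _ hy, hΓ _ hy, Fin.sum_univ_three]
  have hs : √(φ p.1) ≠ 0 := (Real.sqrt_pos.2 (hφ0 _ hp)).ne'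
  simp [coordVec, chrRad, chrSph]
  rw [Real.sq_sqrt (hφ0 _ hp).le]
  field_simp
  ring

end Curvature

theorem isRiemannianOn_warpedMetric {J : Set ℝ} {φ h : ℝ → ℝ} (hφ0 : ∀ s ∈ J, 0 < φ s)
    (hh0 : ∀ s ∈ J, 0 < h s) (hφ : ContDiffOn ℝ ∞ φ J) (hh : ContDiffOn ℝ ∞ h J) :
    IsRiemannianOn (warpedMetric φ h) (J ×ˢ univ) where
  symm p _ v w := by
    erw [warpedMetric_apply, warpedMetric_apply]
    rw [real_inner_comm]
    ring
  pos p hp v hv := by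
    erw [warpedMetric_apply]
    have h1 := hφ0 _ hp.1
    have h2 := hh0 _ hp.1
    rw [real_inner_self_eq_norm_sq]
    by_cases h3 : (v : Coord).1 = 0
    · have h4 : (v : Coord).2 ≠ 0 := fun h4 => hv (Prod.ext h3 h4)
      have h5 : sphereIncl p.2 (v : Coord).2 ≠ 0 := fun h5 =>
        h4 (sphereIncl_injective p.2 (by rw [h5, map_zero]))
      have h6 := norm_pos_iff.2 h5
      have h7 := mul_self_nonneg (v : Coord).1
      positivity
    · have h6 := mul_self_pos.2 h3
      positivity
  smooth p i j := by
    rw [chartDomain_prod]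
    have hconf : ContDiff ℝ ∞ conf := by
      unfold conf
      refine contDiff_const.div ((((contDiff_norm_sq ℝ)).add contDiff_const).pow 2) fun w => ?_
      positivity
    have h1 : ContDiffOn ℝ ∞ (fun y : Coord => φ y.1) (J ×ˢ univ) :=
      hφ.comp contDiff_fst.contDiffOn fun y hy => hy.1
    have h2 : ContDiffOn ℝ ∞ (fun y : Coord => h y.1 ^ 2 * conf y.2) (J ×ˢ univ) :=
      ((hh.comp contDiff_fst.contDiffOn fun y hy => hy.1).pow 2).mul
        (hconf.comp contDiff_snd).contDiffOn
    simp only [coordMetric_warpedMetric]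
    fin_cases i <;> fin_cases j <;> first | exact h1 | exact h2 | exact contDiffOn_const

end

end WarpedGluing

namespace WarpedGluing

noncomputable section

/-! ### Area and Hawking mass of slices -/

theorem sphereMeasure_univ : sphereMeasure univ = ENNReal.ofReal (4 * Real.pi) := by
  rw [sphereMeasure, Measure.toSphere_apply_univ, EuclideanSpace.volume_ball_fin_three,
    finrank_euclideanSpace_fin]
  rw [← ENNReal.ofReal_natCast, ← ENNReal.ofReal_pow (by norm_num),
    ← ENNReal.ofReal_mul (by norm_num), ← ENNReal.ofReal_mul (by norm_num)]
  congr 1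
  norm_num
  ring

theorem pullbackWithin_slice_warpedMetric (φ f : ℝ → ℝ) (s : ℝ) (θ : S2)
    (v w : EuclideanSpace ℝ (Fin 2)) :
    pullbackWithin (I := 𝓡 2) (fun θ : S2 => ((s, θ) : Cyl)) univ (warpedMetric φ f) θ v w =
      f s ^ 2 * roundMetric θ v w := by
  have hd : MDifferentiableWithinAt (𝓡 2) cylModel (fun θ : S2 => ((s, θ) : Cyl)) univ θ :=
    (mdifferentiableAt_const.prodMk mdifferentiableAt_id).mdifferentiableWithinAt
  rw [pullbackWithin_warpedMetric_apply φ f _ hd (uniqueMDiffWithinAt_univ _), roundMetric_apply]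
  have h1 : realDeriv (𝓡 2) (fun _ : S2 => s) univ θ = 0 := by
    rw [realDeriv, mfderivWithin_univ, mfderiv_const]
    rfl
  have h2 : vecDeriv (𝓡 2) (fun z : S2 => (z : E3)) univ θ = sphereIncl θ := by
    rw [vecDeriv, mfderivWithin_univ, sphereIncl]
  rw [h1, h2]
  simp

/-- A Gram determinant of independent vectors. Positivity keeps the quotient in `areaDensity` from
being a division by zero. -/
theorem det_roundMetric_pos (θ : S2) :
    0 < (Matrix.of fun i j : Fin 2 => roundMetric θ
      (EuclideanSpace.single i 1 : EuclideanSpace ℝ (Fin 2))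
      (EuclideanSpace.single j 1 : EuclideanSpace ℝ (Fin 2))).det := by
  simp only [roundMetric_apply]
  have hli : LinearIndependent ℝ fun i : Fin 2 =>
      sphereIncl θ (EuclideanSpace.single i 1 : EuclideanSpace ℝ (Fin 2)) := by
    have h := (EuclideanSpace.basisFun (Fin 2) ℝ).toBasis.linearIndependent
    have h2 := h.map' (sphereIncl θ).toLinearMap (LinearMap.ker_eq_bot.2 (sphereIncl_injective θ))
    convert! h2 using 2 with i
    simp
  exact (Matrix.posDef_gram_of_linearIndependent hli).det_pos

theorem areaMeasure_slice {φ f : ℝ → ℝ} (s : ℝ) :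
    areaMeasure (pullbackWithin (fun θ : S2 => ((s, θ) : Cyl)) univ (warpedMetric φ f)) =
      ENNReal.ofReal (f s ^ 2) • sphereMeasure := by
  rw [areaMeasure, ← withDensity_const]
  congr 1
  funext θ
  congr 1
  have hdet := det_roundMetric_pos θ
  rw [areaDensity]
  have e : (Matrix.of fun i j : Fin 2 =>
      pullbackWithin (I := 𝓡 2) (fun θ : S2 => ((s, θ) : Cyl)) univ (warpedMetric φ f) θ
      (EuclideanSpace.single i 1 : EuclideanSpace ℝ (Fin 2))
      (EuclideanSpace.single j 1 : EuclideanSpace ℝ (Fin 2))) =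
      f s ^ 2 • (Matrix.of fun i j : Fin 2 => roundMetric θ
      (EuclideanSpace.single i 1 : EuclideanSpace ℝ (Fin 2))
      (EuclideanSpace.single j 1 : EuclideanSpace ℝ (Fin 2))) := by
    ext i j
    simp [pullbackWithin_slice_warpedMetric]
  erw [e]
  rw [Matrix.det_smul, Fintype.card_fin, mul_div_assoc]
  erw [div_self hdet.ne']
  rw [mul_one, Real.sqrt_sq (by positivity)]

/-- The Hawking mass of a slice of `ds² + f² g_*` of radius `f` and slope `f'`. -/
def sliceMass (f f' : ℝ) : ℝ := f / 2 * (1 + f ^ 2 - f' ^ 2)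

/-- The slice has area `4π f²` and constant mean curvature `2 f'/f`, so the integral is a product.
-/
theorem sliceHawkingMass_warped {J : Set ℝ} (hJ : UniqueDiffOn ℝ J) {f f' : ℝ → ℝ}
    (hf0 : ∀ s ∈ J, 0 < f s) (hf : ∀ s ∈ J, HasDerivWithinAt f (f' s) J s) {s : ℝ} (hs : s ∈ J) :
    sliceHawkingMass (warpedMetric (fun _ => 1) f) (J ×ˢ univ) s = sliceMass (f s) (f' s) := by
  have hH : ∀ θ : S2, sliceMeanCurvature (warpedMetric (fun _ => 1) f) (J ×ˢ univ) (s, θ) =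
      2 * f' s / f s := fun θ => by
    rw [sliceMeanCurvature_warped hJ (φ := fun _ => 1) (φ' := fun _ => 0) (fun _ _ => one_pos) hf0
      (fun s _ => hasDerivWithinAt_const s J 1) hf (fun _ _ => rfl) (p := (s, θ)) hs]
    simp
  have h0 := hf0 s hs
  have hpi := Real.pi_pos
  have hm : (ENNReal.ofReal (f s ^ 2) • sphereMeasure).real univ = f s ^ 2 * (4 * Real.pi) := by
    rw [measureReal_ennreal_smul_apply, measureReal_def, sphereMeasure_univ,
      ENNReal.toReal_ofReal (by positivity), ENNReal.toReal_ofReal (by positivity)]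
  rw [sliceHawkingMass, hyperbolicHawkingMass, areaMeasure_slice]
  simp only [hH]
  rw [integral_const, hm]
  have hsq : √(f s ^ 2 * (4 * Real.pi) / (16 * Real.pi)) = f s / 2 := by
    rw [show f s ^ 2 * (4 * Real.pi) / (16 * Real.pi) = (f s / 2) ^ 2 by field_simp; ring]
    exact Real.sqrt_sq (by positivity)
  rw [hsq, sliceMass, smul_eq_mul]
  field_simp
  ring

/-! ### Isometries between warped metrics -/

theorem uniqueMDiffWithinAt_prod_univ {J : Set ℝ} (hJ : UniqueDiffOn ℝ J) {p : Cyl}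
    (hp : p.1 ∈ J) : UniqueMDiffWithinAt cylModel (J ×ˢ univ : Set Cyl) p :=
  UniqueMDiffWithinAt.prod (uniqueMDiffWithinAt_iff_uniqueDiffWithinAt.2 (hJ _ hp))
    (uniqueMDiffWithinAt_univ _)

/-- The map `(s, θ) ↦ (s + c, A θ)` of the cylinder. -/
def shiftRotate (c : ℝ) (A : E3 ≃ₗᵢ[ℝ] E3) (p : Cyl) : Cyl := (p.1 + c, (rotate A p).2)

theorem contMDiff_shiftRotate (c : ℝ) (A : E3 ≃ₗᵢ[ℝ] E3) :
    ContMDiff cylModel cylModel ∞ (shiftRotate c A) := by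
  have := fact_finrank_E3
  refine ContMDiff.prodMk ?_ ?_
  · have h : ContMDiff 𝓘(ℝ, ℝ) 𝓘(ℝ, ℝ) ∞ fun s : ℝ => s + c :=
      (contDiff_id.add contDiff_const).contMDiff
    exact h.comp contMDiff_fst
  · have h : ContMDiff (𝓡 2) 𝓘(ℝ, E3) ∞ fun θ : S2 => A (θ : E3) :=
      A.toContinuousLinearEquiv.contDiff.contMDiff.comp contMDiff_coe_sphere
    exact (h.codRestrict_sphere (n := 2) (fun θ => by simp)).comp contMDiff_snd

/-- The shift leaves `ds` unchanged and `A` preserves inner products. This one map serves for the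
rotational symmetry (`c = 0`), for the inclusion of the collar, and for the passage from `s` to the
area radius on the end (`A` the identity). -/
theorem pullbackWithin_shiftRotate {J : Set ℝ} (hJ : UniqueDiffOn ℝ J) {φ f φ₁ f₁ : ℝ → ℝ} (c : ℝ)
    (A : E3 ≃ₗᵢ[ℝ] E3) {p : Cyl} (hp : p.1 ∈ J) (h1 : φ₁ (p.1 + c) = φ p.1)
    (h2 : f₁ (p.1 + c) = f p.1) :
    pullbackWithin (I := cylModel) (shiftRotate c A) (J ×ˢ univ) (warpedMetric φ₁ f₁) p =
      warpedMetric φ f p := by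
  have hu := uniqueMDiffWithinAt_prod_univ hJ hp
  have hd : MDifferentiableWithinAt cylModel cylModel (shiftRotate c A) (J ×ˢ univ) p :=
    ((contMDiff_shiftRotate c A).mdifferentiable (by simp) p).mdifferentiableWithinAt
  refine LinearMap.ext fun v => LinearMap.ext fun w => ?_
  have e := pullbackWithin_warpedMetric_apply φ₁ f₁ (shiftRotate c A) hd hu v w
  refine e.trans ?_
  refine Eq.trans ?_ (warpedMetric_apply φ f p v w).symm
  have e1 : realDeriv cylModel (fun z => (shiftRotate c A z).1) (J ×ˢ univ) p =
      ContinuousLinearMap.fst ℝ ℝ (EuclideanSpace ℝ (Fin 2)) := by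
    rw [realDeriv]
    have h : MDifferentiableAt 𝓘(ℝ, ℝ) 𝓘(ℝ, ℝ) (fun s : ℝ => s + c) p.1 :=
      (differentiableAt_id.add_const c).mdifferentiableAt
    have h3 := mfderiv_comp_mfderivWithin (I := cylModel) (s := J ×ˢ univ) p h
      (mdifferentiableAt_fst.mdifferentiableWithinAt) hu
    refine h3.trans ?_
    rw [mfderivWithin_eq_mfderiv hu mdifferentiableAt_fst, mfderiv_fst, mfderiv_eq_fderiv]
    have h4 : fderiv ℝ (fun s : ℝ => s + c) p.1 = ContinuousLinearMap.id ℝ ℝ :=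
      ((hasFDerivAt_id p.1).add_const c).fderiv
    rw [h4]
    rfl
  have e2 : vecDeriv cylModel (fun z => ((shiftRotate c A z).2 : E3)) (J ×ˢ univ) p =
      (A.toContinuousLinearEquiv : E3 →L[ℝ] E3).comp ((sphereIncl p.2).comp
        (ContinuousLinearMap.snd ℝ ℝ (EuclideanSpace ℝ (Fin 2)))) := by
    rw [vecDeriv]
    have h : MDifferentiableAt 𝓘(ℝ, E3) 𝓘(ℝ, E3) A (p.2 : E3) :=
      A.toContinuousLinearEquiv.differentiableAt.mdifferentiableAt
    have h' : MDifferentiableAt cylModel 𝓘(ℝ, E3) (fun z : Cyl => (z.2 : E3)) p :=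
      (mdifferentiable_coe_sphere p.2).comp p mdifferentiableAt_snd
    have h3 := mfderiv_comp_mfderivWithin (I := cylModel) (s := J ×ˢ univ) p h
      h'.mdifferentiableWithinAt hu
    refine h3.trans ?_
    have h5 : mfderiv cylModel 𝓘(ℝ, E3) (fun z : Cyl => (z.2 : E3)) p = _ :=
      mfderiv_comp p (mdifferentiable_coe_sphere p.2) mdifferentiableAt_snd
    rw [mfderivWithin_eq_mfderiv hu h', h5, mfderiv_snd, mfderiv_eq_fderiv]
    have h4 : fderiv ℝ A (p.2 : E3) = (A.toContinuousLinearEquiv : E3 →L[ℝ] E3) :=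
      A.toContinuousLinearEquiv.fderiv
    rw [h4]
    rfl
  have e3 : (shiftRotate c A p).1 = p.1 + c := rfl
  rw [e1, e2, e3, h1, h2]
  exact congrArg₂ (· + ·) rfl (congrArg₂ (· * ·) rfl (A.inner_map_map _ _))

theorem shiftRotate_comp (c : ℝ) (A : E3 ≃ₗᵢ[ℝ] E3) (p : Cyl) :
    shiftRotate (-c) A.symm (shiftRotate c A p) = p := by
  refine Prod.ext ?_ (Subtype.ext ?_)
  · simp [shiftRotate]
  · simp [shiftRotate, rotate]

theorem isDiffeo_shiftRotate {J J' : Set ℝ} (c : ℝ) (A : E3 ≃ₗᵢ[ℝ] E3)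
    (h : ∀ s, s ∈ J ↔ s + c ∈ J') :
    IsDiffeo cylModel cylModel (J ×ˢ univ) (J' ×ˢ univ) (shiftRotate c A)
      (shiftRotate (-c) A.symm) where
  smooth := (contMDiff_shiftRotate c A).contMDiffOn
  smooth_inv := (contMDiff_shiftRotate (-c) A.symm).contMDiffOn
  mapsTo p hp := ⟨(h _).1 hp.1, trivial⟩
  mapsTo_inv p hp := ⟨(h _).2 (by simpa [shiftRotate] using hp.1), trivial⟩
  left_inv p _ := shiftRotate_comp c A p
  right_inv p _ := by simpa using shiftRotate_comp (-c) A.symm p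

theorem isIsometry_shiftRotate {J J' : Set ℝ} (hJ : UniqueDiffOn ℝ J) {φ f φ₁ f₁ : ℝ → ℝ} (c : ℝ)
    (A : E3 ≃ₗᵢ[ℝ] E3) (h : ∀ s, s ∈ J ↔ s + c ∈ J') (h1 : ∀ s ∈ J, φ₁ (s + c) = φ s)
    (h2 : ∀ s ∈ J, f₁ (s + c) = f s) :
    IsIsometry (warpedMetric φ f) (J ×ˢ univ) (warpedMetric φ₁ f₁) (J' ×ˢ univ)
      (shiftRotate c A) :=
  ⟨⟨_, isDiffeo_shiftRotate c A h⟩, fun _ hp =>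
    pullbackWithin_shiftRotate hJ c A hp.1 (h1 _ hp.1) (h2 _ hp.1)⟩

theorem rotate_eq_shiftRotate (A : E3 ≃ₗᵢ[ℝ] E3) : rotate A = shiftRotate 0 A := by
  funext p
  simp [shiftRotate, rotate]

theorem isRotationallySymmetric_warpedMetric {J : Set ℝ} (hJ : UniqueDiffOn ℝ J) (φ f : ℝ → ℝ) :
    IsRotationallySymmetric (warpedMetric φ f) (J ×ˢ univ) := fun A => by
  rw [rotate_eq_shiftRotate]
  exact isIsometry_shiftRotate hJ 0 A (by simp) (by simp) (by simp)

end

end WarpedGluing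

namespace WarpedGluing

noncomputable section

/-! ### AdS-Schwarzschild metrics are asymptotically hyperbolic -/

/-- The radial coefficient of the AdS-Schwarzschild metric. -/
def adsCoeff (m r : ℝ) : ℝ := (1 + r ^ 2 - 2 * m / r)⁻¹

/-- The derivative of `adsCoeff m`. -/
def adsCoeffDeriv (m r : ℝ) : ℝ := -(2 * r + 2 * m / r ^ 2) * adsCoeff m r ^ 2

theorem adsMetric_eq (m : ℝ) : adsMetric m = warpedMetric (adsCoeff m) id := rfl

theorem hasDerivAt_adsCoeff {m r : ℝ} (hr : r ≠ 0) (hF : 1 + r ^ 2 - 2 * m / r ≠ 0) :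
    HasDerivAt (adsCoeff m) (adsCoeffDeriv m r) r := by
  have h1 : HasDerivAt (fun r : ℝ => 1 + r ^ 2 - 2 * m / r) (2 * r + 2 * m / r ^ 2) r := by
    have h := (((hasDerivAt_id r).pow 2).const_add 1).sub ((hasDerivAt_inv hr).const_mul (2 * m))
    convert! h using 1
    simp
    field_simp
  convert! h1.inv hF using 1
  simp only [adsCoeffDeriv, adsCoeff]
  field_simp

theorem differentiableAt_adsCoeffDeriv {m r : ℝ} (hr : r ≠ 0) (hF : 1 + r ^ 2 - 2 * m / r ≠ 0) :
    DifferentiableAt ℝ (adsCoeffDeriv m) r := by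
  have h := (hasDerivAt_adsCoeff hr hF).differentiableAt
  unfold adsCoeffDeriv
  refine DifferentiableAt.mul ?_ (h.pow 2)
  have : r ^ 2 ≠ 0 := pow_ne_zero 2 hr
  fun_prop (disch := assumption)

/-- From radius `max 1 (2|m|)` on, the mass term is at most `1`. This is why the AdS-Schwarzschild
end starts so far out. -/
theorem sq_le_adsDenominator {m r : ℝ} (h1 : 1 ≤ r) (hm : 2 * |m| ≤ r) :
    r ^ 2 ≤ 1 + r ^ 2 - 2 * m / r := by
  have : 2 * m / r ≤ 1 := by
    rw [div_le_one (by linarith)]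
    linarith [le_abs_self m]
  linarith

theorem scalarCurvature_of_eq_adsMetric {g : Tensor2 cylModel Cyl} {m R₀ : ℝ} (hR₀ : 1 ≤ R₀)
    (hm : 2 * |m| ≤ R₀) (hg : ∀ p ∈ (Ioi R₀ ×ˢ univ : Set Cyl), g p = adsMetric m p)
    {p : Cyl} (hp : p.1 ∈ Ioi R₀) : scalarCurvature g (Ioi R₀ ×ˢ univ) p = -6 := by
  have hpos : ∀ s ∈ Ioi R₀, 0 < s := fun s hs => lt_of_lt_of_le one_pos (hR₀.trans (le_of_lt hs))
  have hF : ∀ s ∈ Ioi R₀, 0 < 1 + s ^ 2 - 2 * m / s := fun s hs =>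
    lt_of_lt_of_le (pow_pos (hpos s hs) 2)
      (sq_le_adsDenominator (hR₀.trans (le_of_lt hs)) (hm.trans (le_of_lt hs)))
  have hd : ∀ s ∈ Ioi R₀, HasDerivAt (adsCoeff m) (adsCoeffDeriv m s) s := fun s hs =>
    hasDerivAt_adsCoeff (hpos s hs).ne' (hF s hs).ne'
  rw [scalarCurvature_warped (φ := adsCoeff m) (h := id) (uniqueDiffOn_Ioi R₀)
    (fun s hs => inv_pos.2 (hF s hs)) hpos
    (fun s hs => (hd s hs).hasDerivWithinAt) (fun s _ => hasDerivWithinAt_id s _) hg hp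
    (differentiableAt_adsCoeffDeriv (hpos _ hp).ne' (hF _ hp).ne').hasDerivAt.hasDerivWithinAt
    (hasDerivWithinAt_const p.1 _ 1)]
  have h1 := (hF _ hp).ne'
  have h2 := (hpos _ hp).ne'
  rw [warpedScalar, adsCoeffDeriv]
  have h3 : adsCoeff m p.1 ≠ 0 := inv_ne_zero h1
  have h4 : (adsCoeff m p.1)⁻¹ = 1 + p.1 ^ 2 - 2 * m / p.1 := inv_inv _
  -- Since `φ' = -F' φ²` for `φ = 1/F`, the scalar curvature becomes affine in `F` and `F'`.
  have e : 2 / id p.1 ^ 2 - 2 * 1 ^ 2 / (adsCoeff m p.1 * id p.1 ^ 2) -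
      4 * 0 / (adsCoeff m p.1 * id p.1) + 2 * 1 * (-(2 * p.1 + 2 * m / p.1 ^ 2) *
        adsCoeff m p.1 ^ 2) / (adsCoeff m p.1 ^ 2 * id p.1) =
      2 / p.1 ^ 2 - 2 * (adsCoeff m p.1)⁻¹ / p.1 ^ 2 - 2 * (2 * p.1 + 2 * m / p.1 ^ 2) / p.1 := by
    simp only [id]
    field_simp
    ring
  rw [e, h4]
  field_simp
  ring

/-! ### Decay of the difference between mass `m` and mass `0` -/

section Decay

variable {m r : ℝ} (h1 : 1 ≤ r) (hm : 2 * |m| ≤ r)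
include h1 hm

theorem adsCoeff_pos : 0 < adsCoeff m r :=
  inv_pos.2 (lt_of_lt_of_le (by positivity) (sq_le_adsDenominator h1 hm))

theorem adsCoeff_le : adsCoeff m r ≤ (r ^ 2)⁻¹ :=
  inv_anti₀ (by positivity) (sq_le_adsDenominator h1 hm)

theorem adsCoeff_sub : adsCoeff m r - adsCoeff 0 r = 2 * m / r * adsCoeff m r * adsCoeff 0 r := by
  have h2 := lt_of_lt_of_le (by positivity) (sq_le_adsDenominator h1 hm)
  have h3 : 0 < 1 + r ^ 2 := by positivity
  have h4 : r ≠ 0 := by positivity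
  simp only [adsCoeff, mul_zero, zero_div, sub_zero]
  rw [inv_sub_inv h2.ne' h3.ne']
  field_simp
  ring

theorem abs_adsCoeff_sub_le : |adsCoeff m r - adsCoeff 0 r| ≤ 2 * |m| / r ^ 5 := by
  have hr : 0 < r := by linarith
  have a := adsCoeff_pos h1 hm
  have b := adsCoeff_le h1 hm
  have c := adsCoeff_pos (m := 0) h1 (by simpa using hr.le)
  have d := adsCoeff_le (m := 0) h1 (by simpa using hr.le)
  rw [adsCoeff_sub h1 hm, abs_mul, abs_mul, abs_of_pos a, abs_of_pos c, abs_div, abs_mul, abs_two,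
    abs_of_pos hr]
  calc 2 * |m| / r * adsCoeff m r * adsCoeff 0 r ≤ 2 * |m| / r * (r ^ 2)⁻¹ * (r ^ 2)⁻¹ := by gcongr
    _ = 2 * |m| / r ^ 5 := by field_simp

/-- For the error `e`, whose only component is `e_00`, this is the size of components such as `∇_1
e_10 = -Γ^0_11 e_00` at the chart centre. The factor `1 + r²` cancels `adsCoeff 0 r`. -/
theorem abs_adsCoeff_sub_mul_le :
    |r * (1 + r ^ 2) * (adsCoeff m r - adsCoeff 0 r)| ≤ 2 * |m| / r ^ 2 := by
  have hr : 0 < r := by linarith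
  have h3 : 0 < 1 + r ^ 2 := by positivity
  have e : r * (1 + r ^ 2) * (adsCoeff m r - adsCoeff 0 r) = 2 * m * adsCoeff m r := by
    rw [adsCoeff_sub h1 hm]
    simp only [adsCoeff, mul_zero, zero_div, sub_zero]
    field_simp
  rw [e, abs_mul, abs_mul, abs_two, abs_of_pos (adsCoeff_pos h1 hm), div_eq_mul_inv]
  have := adsCoeff_le h1 hm
  gcongr

/-- The quantity bounded is `∇_0 e_00`, because the hyperbolic metric has `Γ^0_00 = -r / (1 + r²)`.
-/
theorem abs_adsCoeffDeriv_sub_le :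
    |adsCoeffDeriv m r - adsCoeffDeriv 0 r + 2 * r / (1 + r ^ 2) *
      (adsCoeff m r - adsCoeff 0 r)| ≤ 14 * |m| / r ^ 6 := by
  have hr : 0 < r := by linarith
  have a := adsCoeff_pos h1 hm
  have b := adsCoeff_le h1 hm
  have c := adsCoeff_pos (m := 0) h1 (by simpa using hr.le)
  have d := adsCoeff_le (m := 0) h1 (by simpa using hr.le)
  have e := abs_adsCoeff_sub_le h1 hm
  set x := adsCoeff m r
  set y := adsCoeff 0 r
  have e1 : adsCoeffDeriv m r - adsCoeffDeriv 0 r + 2 * r / (1 + r ^ 2) * (x - y) =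
      (2 * r / (1 + r ^ 2) - 2 * r * (x + y)) * (x - y) - 2 * m / r ^ 2 * x ^ 2 := by
    simp only [adsCoeffDeriv, x, y]
    ring
  have h2 : 2 * r / (1 + r ^ 2) ≤ 2 / r := by
    rw [div_le_div_iff₀ (by positivity) hr]
    nlinarith
  have h3 : 2 * r * (x + y) ≤ 4 / r := by
    calc 2 * r * (x + y) ≤ 2 * r * ((r ^ 2)⁻¹ + (r ^ 2)⁻¹) := by gcongr
      _ = 4 / r := by field_simp; ring
  have h4 : |2 * r / (1 + r ^ 2) - 2 * r * (x + y)| ≤ 6 / r := by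
    have : 0 ≤ 2 * r / (1 + r ^ 2) := by positivity
    have : 0 ≤ 2 * r * (x + y) := by positivity
    have : 6 / r = 2 / r + 4 / r := by ring
    rw [abs_le]
    constructor <;> linarith
  have h5 : |2 * m / r ^ 2 * x ^ 2| ≤ 2 * |m| / r ^ 6 := by
    rw [abs_mul, abs_div, abs_mul, abs_two, abs_of_pos (pow_pos hr 2), abs_of_pos (pow_pos a 2)]
    calc 2 * |m| / r ^ 2 * x ^ 2 ≤ 2 * |m| / r ^ 2 * ((r ^ 2)⁻¹) ^ 2 := by gcongr
      _ = 2 * |m| / r ^ 6 := by field_simp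
  rw [e1]
  calc _ ≤ |(2 * r / (1 + r ^ 2) - 2 * r * (x + y)) * (x - y)| + |2 * m / r ^ 2 * x ^ 2| :=
        abs_sub _ _
    _ ≤ 6 / r * (2 * |m| / r ^ 5) + 2 * |m| / r ^ 6 := by
        rw [abs_mul]
        gcongr
    _ = 14 * |m| / r ^ 6 := by field_simp; ring

end Decay

/-- The coordinate norm of the hyperbolic metric controls the components of a vector. -/
theorem coordNorm_hyperbolic_bounds {r : ℝ} (h1 : 1 ≤ r) (u : Fin 3 → ℝ) :
    let n := coordNorm (warpedMatrix (adsCoeff 0) id) (r, 0) u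
    0 ≤ n ∧ |u 0| ≤ 2 * r * n ∧ |u 1| ≤ n / r ∧ |u 2| ≤ n / r := by
  intro n
  have hr : 0 < r := by linarith
  have hn : n = √(u 0 ^ 2 / (1 + r ^ 2) + r ^ 2 * u 1 ^ 2 + r ^ 2 * u 2 ^ 2) := by
    simp only [n, coordNorm, Fin.sum_univ_three, warpedMatrix, conf_zero]
    simp [adsCoeff]
    congr 1
    ring
  have a0 : 0 ≤ u 0 ^ 2 / (1 + r ^ 2) := by positivity
  have a1 : 0 ≤ r ^ 2 * u 1 ^ 2 := by positivity
  have a2 : 0 ≤ r ^ 2 * u 2 ^ 2 := by positivity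
  have hn0 : 0 ≤ n := by rw [hn]; positivity
  have hn2 : n ^ 2 = u 0 ^ 2 / (1 + r ^ 2) + r ^ 2 * u 1 ^ 2 + r ^ 2 * u 2 ^ 2 := by
    rw [hn, Real.sq_sqrt (by positivity)]
  have h0 : u 0 ^ 2 ≤ n ^ 2 * (1 + r ^ 2) := by
    rw [← div_le_iff₀ (by positivity)]
    linarith
  -- The factor `2r` comes from `1 + r² ≤ 4r²` for `r ≥ 1`.
  refine ⟨hn0, abs_le_of_sq_le_sq ?_ (by positivity), ?_, ?_⟩
  · nlinarith [sq_nonneg n, mul_nonneg (sq_nonneg n) (show 0 ≤ 3 * r ^ 2 - 1 by nlinarith)]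
  all_goals
    rw [le_div_iff₀ hr]
    refine le_of_abs_le (abs_le_of_sq_le_sq ?_ hn0)
    rw [mul_pow, sq_abs]
    nlinarith

/-- The error has a single component `e_00 = O(r⁻⁵)`, and a radial vector component costs a factor
of order `r` relative to its hyperbolic norm, whence the decay `r⁻³`. The integrability condition is
trivial because `R = -6` exactly. -/
theorem isAsymptoticToHyperbolic_of_eq_adsMetric {g : Tensor2 cylModel Cyl} {m R₀ : ℝ}
    (hR₀ : 1 ≤ R₀) (hm : 2 * |m| ≤ R₀)
    (hg : ∀ p ∈ (Ioi R₀ ×ˢ univ : Set Cyl), g p = adsMetric m p) :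
    IsAsymptoticToHyperbolic g R₀ := by
  -- The constant is `14 · 2³ + 2 · 4 · 2 = 128`, from the bound on `∇e`; the bound on `e` itself
  -- needs only `8`.
  refine ⟨⟨3, by norm_num, 128 * |m|, fun p hp => ?_⟩, ?_⟩
  · have hJ := uniqueDiffOn_Ioi R₀
    have h1 : ∀ s ∈ Ioi R₀, 1 ≤ s := fun s hs => hR₀.trans (le_of_lt hs)
    have hpos : ∀ s ∈ Ioi R₀, 0 < s := fun s hs => lt_of_lt_of_le one_pos (h1 s hs)
    have hm' : ∀ s ∈ Ioi R₀, 2 * |m| ≤ s := fun s hs => hm.trans (le_of_lt hs)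
    have hm0 : ∀ s ∈ Ioi R₀, 2 * |(0 : ℝ)| ≤ s := fun s hs => by simpa using (hpos s hs).le
    have hd : ∀ s ∈ Ioi R₀, HasDerivAt (adsCoeff 0) (adsCoeffDeriv 0 s) s := fun s hs =>
      hasDerivAt_adsCoeff (hpos s hs).ne'
        (lt_of_lt_of_le (pow_pos (hpos s hs) 2) (sq_le_adsDenominator (h1 s hs) (hm0 s hs))).ne'
    have hdm : ∀ s ∈ Ioi R₀, HasDerivAt (adsCoeff m) (adsCoeffDeriv m s) s := fun s hs =>
      hasDerivAt_adsCoeff (hpos s hs).ne'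
        (lt_of_lt_of_le (pow_pos (hpos s hs) 2) (sq_le_adsDenominator (h1 s hs) (hm' s hs))).ne'
    have hy : ((p.1, 0) : Coord) ∈ (Ioi R₀ ×ˢ univ : Set Coord) := ⟨hp.1, trivial⟩
    have hB : coordMetric (adsMetric 0) p = warpedMatrix (adsCoeff 0) id := by
      funext z
      rw [adsMetric_eq, coordMetric_warpedMetric, warpedMatrix]
    have he : ∀ z ∈ (Ioi R₀ ×ˢ univ : Set Coord), ∀ i j,
        (coordMetric g p z - warpedMatrix (adsCoeff 0) id z) i j =
        (adsCoeff m z.1 - adsCoeff 0 z.1) *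
          (Matrix.diagonal ![1, 0, 0] : Matrix (Fin 3) (Fin 3) ℝ) i j := by
      intro z hz i j
      rw [coordMetric_of_eq_warpedMetric (φ := adsCoeff m) (h := id) hg p z hz]
      fin_cases i <;> fin_cases j <;> simp [warpedMatrix]
    have hpd : ∀ k i j, pd (Ioi R₀ ×ˢ univ) k
        (fun z => (coordMetric g p z - warpedMatrix (adsCoeff 0) id z) i j) (p.1, 0) =
        (adsCoeffDeriv m p.1 - adsCoeffDeriv 0 p.1) * (coordVec k).1 *
          (Matrix.diagonal ![1, 0, 0] : Matrix (Fin 3) (Fin 3) ℝ) i j := fun k i j => by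
      rw [pd_congr (fun z hz => he z hz i j) hy k]
      refine (pd_mul_apply hJ (y := (p.1, 0)) hp.1 (((hdm _ hp.1).sub
        (hd _ hp.1)).hasDerivWithinAt) (hasFDerivAt_const (𝕜 := ℝ) _ _) k).trans ?_
      simp
    have hΓ := christoffel_of_eq_warpedMetric hJ (φ' := adsCoeffDeriv 0) (h' := fun _ => 1)
      (fun s hs => adsCoeff_pos (h1 s hs) (hm0 s hs)) hpos
      (fun s hs => (hd s hs).hasDerivWithinAt) (fun s _ => hasDerivWithinAt_id s _)
      (g := adsMetric 0) (fun _ _ => rfl) p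
    rw [hB] at hΓ
    have hrp : p.1 ^ (-3 : ℝ) = (p.1 ^ 3)⁻¹ := by
      rw [Real.rpow_neg (hpos _ hp.1).le]
      norm_cast
    simp only [extChartAt_cyl_self, chartDomain_prod, hB, hrp, coordCovDeriv, hpd, hΓ _ hy,
      he _ hy]
    have bnd := coordNorm_hyperbolic_bounds (h1 _ hp.1)
    have k1 := abs_adsCoeff_sub_le (h1 _ hp.1) (hm' _ hp.1)
    have k2 := abs_adsCoeff_sub_mul_le (h1 _ hp.1) (hm' _ hp.1)
    have k3 := abs_adsCoeffDeriv_sub_le (h1 _ hp.1) (hm' _ hp.1)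
    have hr := hpos _ hp.1
    set r := p.1
    have hα : adsCoeffDeriv 0 r / (2 * adsCoeff 0 r) = -(r / (1 + r ^ 2)) := by
      simp only [adsCoeffDeriv, adsCoeff]
      have : 1 + r ^ 2 ≠ 0 := by positivity
      simp
      field_simp
    have hβ : -(r * 1 / adsCoeff 0 r) = -(r * (1 + r ^ 2)) := by
      simp [adsCoeff]
    rw [hα, hβ]
    set ε := adsCoeff m r - adsCoeff 0 r
    set ε' := adsCoeffDeriv m r - adsCoeffDeriv 0 r
    constructor
    · intro v w
      obtain ⟨nv, v0, -, -⟩ := bnd v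
      obtain ⟨nw, w0, -, -⟩ := bnd w
      set N := coordNorm (warpedMatrix (adsCoeff 0) id) (r, 0)
      have e : (∑ i, ∑ j, ε * (Matrix.diagonal ![1, 0, 0] : Matrix (Fin 3) (Fin 3) ℝ) i j * v i *
          w j) = ε * v 0 * w 0 := by
        simp [Fin.sum_univ_three]
      rw [e, abs_mul, abs_mul]
      calc |ε| * |v 0| * |w 0| ≤ (2 * |m| / r ^ 5) * (2 * r * N v) * (2 * r * N w) := by gcongr
        _ = 8 * |m| * (r ^ 3)⁻¹ * N v * N w := by field_simp; ring
        _ ≤ 128 * |m| * (r ^ 3)⁻¹ * N v * N w := by gcongr; norm_num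
    · intro u v w
      obtain ⟨nu, u0, u1, u2⟩ := bnd u
      obtain ⟨nv, v0, v1, v2⟩ := bnd v
      obtain ⟨nw, w0, w1, w2⟩ := bnd w
      set N := coordNorm (warpedMatrix (adsCoeff 0) id) (r, 0)
      set X := r * (1 + r ^ 2) * ε
      set Y := ε' + 2 * r / (1 + r ^ 2) * ε
      -- These are the five nonzero components of `∇e`: the purely radial one, and four mixed ones
      -- of common size `X`.
      have e : ∀ T : ℝ, T = Y * u 0 * v 0 * w 0 + X * (u 1 * v 1 * w 0 + u 2 * v 2 * w 0 +
          u 1 * v 0 * w 1 + u 2 * v 0 * w 2) → |T| ≤ 128 * |m| * (r ^ 3)⁻¹ * N u * N v * N w := by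
        rintro T rfl
        calc _ ≤ |Y| * |u 0| * |v 0| * |w 0| + |X| * (|u 1| * |v 1| * |w 0| + |u 2| * |v 2| * |w 0|
              + |u 1| * |v 0| * |w 1| + |u 2| * |v 0| * |w 2|) := by
              refine (abs_add_le _ _).trans ?_
              simp only [abs_mul]
              gcongr
              refine (abs_add_le _ _).trans ?_
              refine add_le_add ((abs_add_le _ _).trans (add_le_add ((abs_add_le _ _).trans ?_) ?_)) ?_
              all_goals simp only [abs_mul]; exact le_rfl
          _ ≤ (14 * |m| / r ^ 6) * (2 * r * N u) * (2 * r * N v) * (2 * r * N w) +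
              (2 * |m| / r ^ 2) * ((N u / r) * (N v / r) * (2 * r * N w) +
              (N u / r) * (N v / r) * (2 * r * N w) + (N u / r) * (2 * r * N v) * (N w / r) +
              (N u / r) * (2 * r * N v) * (N w / r)) := by gcongr
          _ = 128 * |m| * (r ^ 3)⁻¹ * N u * N v * N w := by field_simp; ring
      refine e _ ?_
      simp only [Fin.sum_univ_three]
      simp [chrRad, chrSph, conf_zero, confLog_zero, coordVec, X, Y]
      ring
  · refine integrableOn_zero.congr_fun (fun p hp => ?_) (measurableSet_Ioi.prod .univ)
    rw [scalarCurvature_of_eq_adsMetric hR₀ hm hg hp.1]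
    simp

end

end WarpedGluing

namespace WarpedGluing

noncomputable section

/-! ### Mass functions -/

/-- The Hawking mass of the slices of `ds² + f² g_*` grows with rate `f' f² (R + 6) / 4`. -/
theorem hasDerivWithinAt_sliceMass {J : Set ℝ} {f f₁ : ℝ → ℝ} {f₂ s : ℝ} (h0 : f s ≠ 0)
    (hf : HasDerivWithinAt f (f₁ s) J s) (hf₁ : HasDerivWithinAt f₁ f₂ J s) :
    HasDerivWithinAt (fun s => sliceMass (f s) (f₁ s))
      (f₁ s * f s ^ 2 / 4 * (warpedScalar 1 0 (f s) (f₁ s) f₂ + 6)) J s := by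
  have h := (hf.div_const 2).mul (((hf.pow 2).const_add 1).sub (hf₁.pow 2))
  convert! h using 1
  simp [warpedScalar]
  field_simp
  ring

/-- The scalar curvature of `(h')² / F ds² + h² g_*` for `F = 1 + h² - 2 μ / h`. -/
theorem warpedScalar_of_mass {U : Set ℝ} (hU : IsOpen U) {h h₁ μ φ : ℝ → ℝ} {h₂ μ₁ φ₁ s : ℝ}
    (hs : s ∈ U) (hφ : ∀ t ∈ U, φ t = h₁ t ^ 2 / (1 + h t ^ 2 - 2 * μ t / h t))
    (hF : 0 < 1 + h s ^ 2 - 2 * μ s / h s) (h0 : 0 < h s) (h10 : 0 < h₁ s)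
    (hh : HasDerivAt h (h₁ s) s) (hh₁ : HasDerivAt h₁ h₂ s) (hμ : HasDerivAt μ μ₁ s)
    (hφ₁ : HasDerivAt φ φ₁ s) :
    warpedScalar (φ s) φ₁ (h s) (h₁ s) h₂ = -6 + 4 * μ₁ / (h s ^ 2 * h₁ s) := by
  have hF' : HasDerivAt (fun t => 1 + h t ^ 2 - 2 * μ t / h t) _ s :=
    ((hh.pow 2).const_add 1).sub ((hμ.const_mul 2).div hh h0.ne')
  have hq := (hh₁.pow 2).div hF' hF.ne'
  have e := hφ₁.unique (hq.congr_of_eventuallyEq (Filter.eventually_of_mem (hU.mem_nhds hs) hφ))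
  rw [e, hφ s hs, warpedScalar]
  have hn := h0.ne'
  have h1n := h10.ne'
  set F := 1 + h s ^ 2 - 2 * μ s / h s with hFd
  have hFn := hF.ne'
  -- Trading `μ` for `F` leaves `F` as an independent quantity; what remains is an algebraic
  -- identity in which `h''` cancels.
  have hμe : μ s = h s * (1 + h s ^ 2 - F) / 2 := by
    rw [hFd]; field_simp; ring
  simp only [Pi.pow_apply]
  rw [hμe]
  field_simp
  ring

/-! ### Cutoffs and gluing of functions -/

theorem exists_cutoff {c d : ℝ} (hcd : c < d) : ∃ χ : ℝ → ℝ, ContDiff ℝ ∞ χ ∧ Antitone χ ∧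
    (∀ s ≤ c, χ s = 1) ∧ (∀ s, d ≤ s → χ s = 0) ∧ ∀ s, 0 ≤ χ s ∧ χ s ≤ 1 := by
  have h0 : 0 < d - c := sub_pos.2 hcd
  refine ⟨fun s => 1 - Real.smoothTransition ((s - c) / (d - c)), ?_, ?_, ?_, ?_, ?_⟩
  · exact contDiff_const.sub (Real.smoothTransition.contDiff.comp
      ((contDiff_id.sub contDiff_const).div_const _))
  · intro s t hst
    have := Real.smoothTransition.monotone
      (div_le_div_of_nonneg_right (sub_le_sub_right hst c) h0.le)
    simp only
    linarith
  · intro s hs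
    have := Real.smoothTransition.zero_of_nonpos
      (div_nonpos_of_nonpos_of_nonneg (sub_nonpos.2 hs) h0.le)
    simp [this]
  · intro s hs
    have := Real.smoothTransition.one_of_one_le
      ((one_le_div h0).2 (sub_le_sub_right hs c))
    simp [this]
  · intro s
    have h1 := Real.smoothTransition.nonneg ((s - c) / (d - c))
    have h2 := Real.smoothTransition.le_one ((s - c) / (d - c))
    constructor <;> linarith

/-- The interpolation `χ u + (1 - χ) v`. -/
def glue (χ u v : ℝ → ℝ) (s : ℝ) : ℝ := χ s * u s + (1 - χ s) * v s

theorem Ici_eventuallyEq_Icc {a b s : ℝ} (hs : s < b) : Ici a =ᶠ[𝓝 s] Icc a b := by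
  filter_upwards [Iio_mem_nhds hs] with t ht
  exact propext ⟨fun h => ⟨h, ht.le⟩, fun h => h.1⟩

/-- The function `u` is controlled only on `[a, b]`, one-sidedly at `a`. The cutoff vanishes from `d
< b` on, so the values of `u` near and beyond `b` do not matter. -/
theorem contDiffOn_glue {a b d : ℝ} (hd : d < b) {χ u v : ℝ → ℝ} (hχ : ContDiff ℝ ∞ χ)
    (hχ0 : ∀ s, d ≤ s → χ s = 0) (hu : ContDiffOn ℝ ∞ u (Icc a b)) (hv : ContDiff ℝ ∞ v) :
    ContDiffOn ℝ ∞ (glue χ u v) (Ici a) := by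
  intro s hs
  rcases lt_or_ge s b with h | h
  · have hsb : s ∈ Icc a b := ⟨hs, h.le⟩
    refine ContDiffWithinAt.mono_of_mem_nhdsWithin (s := Icc a b) ?_ ?_
    · exact (hχ.contDiffWithinAt.mul (hu s hsb)).add
        ((contDiffWithinAt_const.sub hχ.contDiffWithinAt).mul hv.contDiffWithinAt)
    · rw [nhdsWithin_eq_iff_eventuallyEq.2 (Ici_eventuallyEq_Icc h)]
      exact self_mem_nhdsWithin
  · refine (hv.contDiffAt.congr_of_eventuallyEq ?_).contDiffWithinAt
    filter_upwards [Ioi_mem_nhds (hd.trans_le h)] with t ht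
    simp [glue, hχ0 t (le_of_lt ht)]

/-- The last term is nonnegative when `χ` decreases and `u ≤ v`: passing from a lower increasing
function to a higher one preserves monotonicity. -/
theorem hasDerivAt_glue {χ u v : ℝ → ℝ} {χ' u' v' s : ℝ} (hχ : HasDerivAt χ χ' s)
    (hu : HasDerivAt u u' s) (hv : HasDerivAt v v' s) :
    HasDerivAt (glue χ u v) (χ s * u' + (1 - χ s) * v' + χ' * (u s - v s)) s := by
  have h := (hχ.mul hu).add ((hχ.const_sub 1).mul hv)
  convert! h using 1
  ring

theorem hasDerivAt_glue_of_lt {d : ℝ} {χ u v : ℝ → ℝ} {v' s : ℝ} (hχ0 : ∀ s, d ≤ s → χ s = 0)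
    (hs : d < s) (hv : HasDerivAt v v' s) : HasDerivAt (glue χ u v) v' s := by
  refine hv.congr_of_eventuallyEq ?_
  filter_upwards [Ioi_mem_nhds hs] with t ht
  simp [glue, hχ0 t (le_of_lt ht)]

theorem derivWithin_Ici_eq_of_eqOn {a b c : ℝ} (hc : c ≤ b) {u v : ℝ → ℝ}
    (h : ∀ t ∈ Ico a c, u t = v t) {s : ℝ} (hs : s ∈ Ico a c) :
    derivWithin u (Ici a) s = derivWithin v (Icc a b) s := by
  rw [← derivWithin_congr_set (Ici_eventuallyEq_Icc (hs.2.trans_le hc))]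
  refine Filter.EventuallyEq.derivWithin_eq ?_ (h s hs)
  filter_upwards [self_mem_nhdsWithin, mem_nhdsWithin_of_mem_nhds (Iio_mem_nhds hs.2)]
    with t h1 h2
  exact h t ⟨h1, h2⟩

/-- At a root `r + r³ = 2m`, hence `r ≤ 2m`. -/
theorem horizonRadius_le (m : ℝ) : horizonRadius m ≤ 2 * |m| := by
  unfold horizonRadius
  split_ifs with h
  · refine Real.sSup_le ?_ (by positivity)
    rintro r ⟨hr, he⟩
    rw [abs_of_pos h]
    have : 2 * m = r * (1 + r ^ 2) := by
      field_simp at he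
      linarith
    nlinarith [pow_pos hr 3]
  · positivity

end

end WarpedGluing

namespace WarpedGluing

noncomputable section

/-! ### The extension of a collar -/

/-- A smooth increasing radius function and a smooth nondecreasing mass function which agree with
those of the given collar up to `c₁`, and with those of an AdS-Schwarzschild manifold for large
arguments. -/
theorem exists_radius_mass {a b : ℝ} (hab : a < b) {f : ℝ → ℝ}
    (hf : ContDiffOn ℝ ∞ f (Icc a b)) (hf0 : ∀ s ∈ Icc a b, 0 < f s)
    (hfb : 0 < derivWithin f (Icc a b) b)
    (hR : ∀ s ∈ Icc a b, -6 < warpedScalar 1 0 (f s) (derivWithin f (Icc a b) s)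
      (derivWithin (derivWithin f (Icc a b)) (Icc a b) s))
    {m : ℝ} (hm : sliceMass (f b) (derivWithin f (Icc a b) b) < m) :
    ∃ c₀ c₁ S C : ℝ, ∃ h μ : ℝ → ℝ, (a + b) / 2 < c₀ ∧ c₀ < c₁ ∧ c₁ < b ∧ b < S ∧
      2 * |m| + 1 ≤ S + C ∧ ContDiffOn ℝ ∞ h (Ici a) ∧ ContDiffOn ℝ ∞ μ (Ici a) ∧
      (∀ s ∈ Ici a, 0 < h s) ∧ (∀ s ∈ Ioi c₀, 0 < 1 + h s ^ 2 - 2 * μ s / h s) ∧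
      (∀ s ∈ Ioi c₀, 0 < deriv h s) ∧ (∀ s ∈ Ioi c₀, 0 ≤ deriv μ s) ∧
      (∀ s ∈ Ico a c₁, h s = f s) ∧
      (∀ s ∈ Ico a c₁, μ s = sliceMass (f s) (derivWithin f (Icc a b) s)) ∧
      (∀ s ∈ Ioi S, h s = s + C) ∧ ∀ s ∈ Ioi S, μ s = m := by
  have hu := uniqueDiffOn_Icc hab
  set f₁ := derivWithin f (Icc a b) with hf₁
  have hf₁s : ContDiffOn ℝ ∞ f₁ (Icc a b) := hf.derivWithin hu (by simp)
  set f₂ := derivWithin f₁ (Icc a b) with hf₂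
  have hbI : b ∈ Icc a b := right_mem_Icc.2 hab.le
  have hdf : ∀ s ∈ Icc a b, HasDerivWithinAt f (f₁ s) (Icc a b) s := fun s hs =>
    (hf.differentiableOn (by simp) s hs).hasDerivWithinAt
  have hdf₁ : ∀ s ∈ Icc a b, HasDerivWithinAt f₁ (f₂ s) (Icc a b) s := fun s hs =>
    (hf₁s.differentiableOn (by simp) s hs).hasDerivWithinAt
  set w : ℝ → ℝ := fun s => sliceMass (f s) (f₁ s) with hw
  have hws : ContDiffOn ℝ ∞ w (Icc a b) :=
    (hf.div_const 2).mul ((contDiffOn_const.add (hf.pow 2)).sub (hf₁s.pow 2))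
  have hdw : ∀ s ∈ Icc a b, HasDerivWithinAt w _ (Icc a b) s := fun s hs =>
    hasDerivWithinAt_sliceMass (hf0 s hs).ne' (hdf s hs) (hdf₁ s hs)
  -- a neighbourhood of `b` where `f` increases and there is room for the mass `w b`
  have hroom : w b < (f b + f b ^ 3) / 2 := by
    have := hf0 b hbI
    simp only [hw, sliceMass]
    -- The slack in `w b = (f + f³ - f f'²) / 2` at `b` is the term `f f'² / 2`.
    have h1 : 0 < f b * f₁ b ^ 2 := by positivity
    nlinarith
  obtain ⟨c₀, hc₀, hc₀b, hnear⟩ : ∃ c₀, (a + b) / 2 < c₀ ∧ c₀ < b ∧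
      ∀ s ∈ Icc c₀ b, 0 < f₁ s ∧ w b < (f s + f s ^ 3) / 2 := by
    have h1 : ∀ᶠ s in 𝓝[Icc a b] b, 0 < f₁ s :=
      (hf₁s.continuousOn b hbI).eventually_const_lt hfb
    have h2 : ∀ᶠ s in 𝓝[Icc a b] b, w b < (f s + f s ^ 3) / 2 :=
      (((hf.continuousOn b hbI).add ((hf.continuousOn b hbI).pow 3)).div_const 2).eventually_const_lt
        hroom
    rw [nhdsWithin_Icc_eq_nhdsLE hab] at h1 h2
    obtain ⟨l, hl, hlb⟩ := (mem_nhdsLE_iff_exists_Icc_subset (a := b)).1 (h1.and h2)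
    refine ⟨max l (((a + b) / 2 + b) / 2), lt_max_of_lt_right (by linarith),
      max_lt hl (by linarith), fun s hs => hlb ⟨(le_max_left _ _).trans hs.1, hs.2⟩⟩
  have hac₀ : a < c₀ := by linarith
  have hIcc : ∀ s ∈ Icc c₀ b, s ∈ Icc a b := fun s hs => ⟨hac₀.le.trans hs.1, hs.2⟩
  have hat : ∀ {u : ℝ → ℝ} {u' s : ℝ}, s ∈ Ioo a b → HasDerivWithinAt u u' (Icc a b) s →
      HasDerivAt u u' s := fun hs hd => hd.hasDerivAt (Icc_mem_nhds hs.1 hs.2)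
  have hw' : ∀ s ∈ Ioo c₀ b, ∃ w', 0 ≤ w' ∧ HasDerivAt w w' s := fun s hs => by
    have hs' : s ∈ Icc c₀ b := ⟨hs.1.le, hs.2.le⟩
    refine ⟨_, ?_, hat ⟨hac₀.trans hs.1, hs.2⟩ (hdw s (hIcc s hs'))⟩
    have h1 := (hnear s hs').1
    have h2 := hR s (hIcc s hs')
    have h3 : 0 < warpedScalar 1 0 (f s) (f₁ s) (f₂ s) + 6 := by linarith
    positivity
  have hwle : ∀ s ∈ Icc c₀ b, w s ≤ w b := by
    have hmono : MonotoneOn w (Icc c₀ b) := by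
      refine monotoneOn_of_deriv_nonneg (convex_Icc _ _) (hws.continuousOn.mono hIcc) ?_ ?_
      · rw [interior_Icc]
        intro s hs
        obtain ⟨w', -, hd⟩ := hw' s hs
        exact hd.differentiableAt.differentiableWithinAt
      · rw [interior_Icc]
        intro s hs
        obtain ⟨w', h0, hd⟩ := hw' s hs
        rwa [hd.deriv]
    exact fun s hs => hmono hs ⟨hc₀b.le, le_rfl⟩ hs.2
  -- the constants
  obtain ⟨c₁, hc₁, hc₁b⟩ := exists_between hc₀b
  -- The cutoff `χ` drops from `1` at `c₁` to `0` at `d`, inside the region where `f` increases and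
  -- short of the end `b`.
  obtain ⟨d, hd, hdb⟩ := exists_between hc₁b
  obtain ⟨B, hB⟩ := isCompact_Icc.bddAbove_image hf.continuousOn
  have hfB : ∀ s ∈ Icc a b, f s ≤ B := fun s hs => hB (mem_image_of_mem f hs)
  -- With this `C` the line `s + C` starts at the upper bound `B` of `f`, so it lies above `f` on
  -- all of `[a, b]`.
  set C := B - a with hC
  have hfL : ∀ s ∈ Icc a b, f s ≤ s + C := fun s hs => by
    have := hfB s hs
    have := hs.1
    linarith
  -- The mass is raised from `w b` to `m` on `[T, T + 1]`, where the radius `s + C` is already at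
  -- least `2|m| + 1`.
  set T := max (b + 1) (2 * |m| + 1 - C) with hT
  have hTb : b < T := lt_max_of_lt_left (by linarith)
  have hTm : 2 * |m| + 1 ≤ T + C := by
    have := le_max_right (b + 1) (2 * |m| + 1 - C)
    linarith
  obtain ⟨χ, hχ, hχa, hχ1, hχ0, hχb⟩ := exists_cutoff hd
  obtain ⟨ψ, hψ, hψa, hψ1, hψ0, hψb⟩ := exists_cutoff (lt_add_one T)
  have hL : ContDiff ℝ ∞ fun s : ℝ => s + C := contDiff_id.add contDiff_const
  have hL' : ∀ s : ℝ, HasDerivAt (fun s : ℝ => s + C) 1 s := fun s => (hasDerivAt_id s).add_const C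
  have hχd : ∀ s, HasDerivAt χ (deriv χ s) s := fun s =>
    (hχ.differentiable (by simp) s).hasDerivAt
  have hψd : ∀ s, HasDerivAt ψ (deriv ψ s) s := fun s =>
    (hψ.differentiable (by simp) s).hasDerivAt
  set h := glue χ f fun s => s + C with hh
  set μ₀ := glue χ w fun _ => w b with hμ₀
  set μ : ℝ → ℝ := fun s => μ₀ s + (m - w b) * (1 - ψ s) with hμ
  have hfh : ∀ s ∈ Icc a b, f s ≤ h s := fun s hs => by
    have h1 := mul_le_mul_of_nonneg_left (hfL s hs) (sub_nonneg.2 (hχb s).2)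
    simp only [hh, glue]
    linarith
  have hhL : ∀ s, d ≤ s → h s = s + C := fun s hs => by simp [hh, glue, hχ0 s hs]
  have hfbC := hfL b hbI
  have hfb0 := hf0 b hbI
  have hμ₀le : ∀ s ∈ Ioi c₀, μ₀ s ≤ w b := fun s hs => by
    rcases le_or_gt s b with hsb | hsb
    · have h1 := mul_le_mul_of_nonneg_left (hwle s ⟨le_of_lt hs, hsb⟩) (hχb s).1
      simp only [hμ₀, glue]
      linarith
    · simp [hμ₀, glue, hχ0 s (hdb.trans hsb).le]
  have hcube : ∀ x y : ℝ, 0 < x → x ≤ y → (x + x ^ 3) / 2 ≤ (y + y ^ 3) / 2 := fun x y hx hxy => by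
    have := pow_le_pow_left₀ hx.le hxy 3
    linarith
  have hh0 : ∀ s ∈ Ici a, 0 < h s := fun s hs => by
    rcases le_or_gt s b with hsb | hsb
    · exact (hf0 s ⟨hs, hsb⟩).trans_le (hfh s ⟨hs, hsb⟩)
    · rw [hhL s (hdb.trans hsb).le]
      linarith
  refine ⟨c₀, c₁, T + 1, C, h, μ, hc₀, hc₁, hc₁b, by linarith, by linarith,
    contDiffOn_glue hdb hχ hχ0 hf hL,
    (contDiffOn_glue hdb hχ hχ0 hws contDiff_const).add
      (contDiff_const.mul (contDiff_const.sub hψ)).contDiffOn, hh0, ?_, ?_, ?_, ?_, ?_, ?_, ?_⟩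
  · intro s hs
    have hs' : c₀ < s := hs
    have hpos := hh0 s (hac₀.trans hs').le
    -- This is `F > 0` multiplied by `h/2`. Up to `T` it follows from `μ ≤ w b` and the room near
    -- `b`, as the radius only gets larger; beyond `T` it follows from `μ ≤ m` and the large radius.
    suffices hlt : μ s < (h s + h s ^ 3) / 2 by
      rw [sub_pos, div_lt_iff₀ hpos]
      nlinarith
    have h0 := hμ₀le s hs
    rcases le_or_gt s T with hsT | hsT
    · have h1 : μ s ≤ w b := by simpa [hμ, hψ1 s hsT] using h0
      refine h1.trans_lt ?_
      rcases le_or_gt s b with hsb | hsb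
      · have hsI : s ∈ Icc c₀ b := ⟨hs'.le, hsb⟩
        exact (hnear s hsI).2.trans_le (hcube _ _ (hf0 s (hIcc s hsI)) (hfh s (hIcc s hsI)))
      · refine hroom.trans_le (hcube _ _ hfb0 ?_)
        rw [hhL s (hdb.trans hsb).le]
        linarith
    · have h1 : (m - w b) * (1 - ψ s) ≤ m - w b :=
        mul_le_of_le_one_right (by linarith) (by linarith [(hψb s).1])
      have h2 : μ s ≤ m := by
        simp only [hμ]
        linarith
      have h3 : 2 * |m| + 1 ≤ h s := by
        rw [hhL s (by linarith)]
        linarith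
      have h4 := le_abs_self m
      have h5 := abs_nonneg m
      have h6 : h s ≤ h s ^ 3 := le_self_pow₀ (by linarith) (by norm_num)
      linarith
  · intro s hs
    have hs' : c₀ < s := hs
    rcases lt_or_ge s b with hsb | hsb
    · have hsI : s ∈ Icc c₀ b := ⟨hs'.le, hsb.le⟩
      rw [(hasDerivAt_glue (hχd s) (hat ⟨hac₀.trans hs', hsb⟩ (hdf s (hIcc s hsI))) (hL' s)).deriv]
      have h1 := (hnear s hsI).1
      have h2 := mul_nonneg_of_nonpos_of_nonpos (hχa.deriv_nonpos (x := s))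
        (sub_nonpos.2 (hfL s (hIcc s hsI)))
      have h3 : 0 < χ s * f₁ s + (1 - χ s) * 1 := by
        obtain ⟨h4, h5⟩ := hχb s
        rcases h4.eq_or_lt with h6 | h6
        · rw [← h6]; norm_num
        · have := mul_pos h6 h1
          linarith
      exact add_pos_of_pos_of_nonneg h3 h2
    · rw [(hasDerivAt_glue_of_lt hχ0 (hdb.trans_le hsb) (hL' s)).deriv]
      exact one_pos
  · intro s hs
    have hs' : c₀ < s := hs
    have hψ' : HasDerivAt (fun s => (m - w b) * (1 - ψ s)) ((m - w b) * (-deriv ψ s)) s :=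
      ((hψd s).const_sub 1).const_mul _
    have hψn : 0 ≤ (m - w b) * (-deriv ψ s) :=
      mul_nonneg (by linarith) (neg_nonneg.2 hψa.deriv_nonpos)
    rcases lt_or_ge s b with hsb | hsb
    · obtain ⟨w', hw0, hwd⟩ := hw' s ⟨hs', hsb⟩
      have hμd : HasDerivAt μ _ s :=
        (hasDerivAt_glue (hχd s) hwd (hasDerivAt_const s (w b))).add hψ'
      rw [hμd.deriv]
      have h2 := mul_nonneg_of_nonpos_of_nonpos (hχa.deriv_nonpos (x := s))
        (sub_nonpos.2 (hwle s ⟨hs'.le, hsb.le⟩))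
      have h3 := mul_nonneg (hχb s).1 hw0
      linarith
    · have hμd : HasDerivAt μ _ s :=
        (hasDerivAt_glue_of_lt hχ0 (hdb.trans_le hsb) (hasDerivAt_const s (w b))).add hψ'
      rw [hμd.deriv]
      linarith
  · intro s hs
    simp [hh, glue, hχ1 s hs.2.le]
  · intro s hs
    have : s ≤ T := by linarith [hs.2]
    simp [hμ, hμ₀, glue, hχ1 s hs.2.le, hψ1 s this, hw]
  · intro s hs
    have hs' : T + 1 < s := hs
    exact hhL s (by linarith)
  · intro s hs
    have hs' : T + 1 < s := hs
    simp [hμ, hμ₀, glue, hχ0 s (by linarith), hψ0 s hs'.le]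

/-- The extension of the collar `ds² + f² g_*` by a warped metric `φ ds² + h² g_*`. -/
theorem exists_profile {a b : ℝ} (hab : a < b) {f : ℝ → ℝ}
    (hf : ContDiffOn ℝ ∞ f (Icc a b)) (hf0 : ∀ s ∈ Icc a b, 0 < f s)
    (hfb : 0 < derivWithin f (Icc a b) b)
    (hR : ∀ s ∈ Icc a b, -6 < warpedScalar 1 0 (f s) (derivWithin f (Icc a b) s)
      (derivWithin (derivWithin f (Icc a b)) (Icc a b) s))
    {m : ℝ} (hm : sliceMass (f b) (derivWithin f (Icc a b) b) < m) :
    ∃ S C : ℝ, ∃ φ h : ℝ → ℝ, a < S ∧ 2 * |m| + 1 ≤ S + C ∧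
      ContDiffOn ℝ ∞ φ (Ici a) ∧ ContDiffOn ℝ ∞ h (Ici a) ∧
      (∀ s ∈ Ici a, 0 < φ s) ∧ (∀ s ∈ Ici a, 0 < h s) ∧
      (∀ s ∈ Icc a ((a + b) / 2), φ s = 1 ∧ h s = f s) ∧
      (∀ s ∈ Ici a, -6 ≤ warpedScalar (φ s) (derivWithin φ (Ici a) s) (h s)
        (derivWithin h (Ici a) s) (derivWithin (derivWithin h (Ici a)) (Ici a) s)) ∧
      (∀ s ∈ Ioi S, φ s = adsCoeff m (s + C) ∧ h s = s + C) ∧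
      ((∀ s ∈ Icc a b, 0 < derivWithin f (Icc a b) s) →
        ∀ s ∈ Ici a, 0 < derivWithin h (Ici a) s) := by
  obtain ⟨c₀, c₁, S, C, h, μ, hc₀, hc₁, hc₁b, hS, hSC, hhs, hμs, hh0, hF, hh', hμ', hhf, hμf, hhS,
    hμS⟩ := exists_radius_mass hab hf hf0 hfb hR hm
  have hac₀ : a < c₀ := by linarith
  have hua := uniqueDiffOn_Ici a
  set h₁ := derivWithin h (Ici a) with hh₁
  have hh₁s : ContDiffOn ℝ ∞ h₁ (Ici a) := hhs.derivWithin hua (by simp)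
  have hnhds : ∀ s ∈ Ioi c₀, Ici a ∈ 𝓝 s := fun s hs => Ici_mem_nhds (hac₀.trans hs)
  have hh₁d : ∀ s ∈ Ioi c₀, h₁ s = deriv h s := fun s hs => derivWithin_of_mem_nhds (hnhds s hs)
  have hh₁f : ∀ s ∈ Ico a c₁, h₁ s = derivWithin f (Icc a b) s := fun s hs =>
    derivWithin_Ici_eq_of_eqOn hc₁b.le hhf hs
  set F : ℝ → ℝ := fun s => 1 + h s ^ 2 - 2 * μ s / h s with hFd
  -- The mass form `h₁² / F` is meaningful only where the radius increases, which may fail near `a`;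
  -- there the collar is kept with coefficient `1`. On the overlap `(c₀, c₁)` the two agree, because
  -- the Hawking mass of the collar makes `F = f'²`. Thus `φ` is smooth across `c₁`.
  set φ : ℝ → ℝ := fun s => if s < c₁ then 1 else h₁ s ^ 2 / F s with hφ
  have hφ1 : ∀ s ∈ Iio c₁, φ s = 1 := fun s hs => if_pos hs
  have hφF : ∀ s ∈ Ioi c₀, φ s = h₁ s ^ 2 / F s := fun s hs => by
    by_cases hsc : s < c₁
    · have hsI : s ∈ Ico a c₁ := ⟨(hac₀.trans hs).le, hsc⟩
      have h0 := hh0 s hsI.1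
      have e : F s = h₁ s ^ 2 := by
        simp only [hFd, hμf s hsI, hh₁f s hsI, sliceMass]
        rw [hhf s hsI] at h0 ⊢
        field_simp
        ring
      have h1 : 0 < h₁ s := by rw [hh₁d s hs]; exact hh' s hs
      rw [hφ1 s hsc, e, div_self (by positivity)]
    · exact if_neg hsc
  have hcover : ∀ s ∈ Ici a, s ∈ Ico a c₁ ∨ s ∈ Ioi c₀ := fun s hs => by
    rcases lt_or_ge s c₁ with h1 | h1
    · exact Or.inl ⟨hs, h1⟩
    · exact Or.inr (hc₁.trans_le h1)
  have hFs : ContDiffOn ℝ ∞ F (Ici a) :=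
    (contDiffOn_const.add (hhs.pow 2)).sub
      ((contDiffOn_const.mul hμs).div hhs fun s hs => (hh0 s hs).ne')
  have hφs : ContDiffOn ℝ ∞ φ (Ici a) := by
    intro s hs
    rcases hcover s hs with h1 | h1
    · refine (contDiffAt_const (c := (1 : ℝ))).congr_of_eventuallyEq ?_ |>.contDiffWithinAt
      filter_upwards [Iio_mem_nhds h1.2] with t ht using hφ1 t ht
    · refine ContDiffWithinAt.congr_of_eventuallyEq
        (((hh₁s s hs).pow 2).div (hFs s hs) (hF s h1).ne') ?_ (hφF s h1)
      filter_upwards [mem_nhdsWithin_of_mem_nhds (Ioi_mem_nhds h1)] with t ht using hφF t ht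
  refine ⟨S, C, φ, h, by linarith, hSC, hφs, hhs, ?_, hh0, ?_, ?_, ?_, ?_⟩
  · intro s hs
    rcases hcover s hs with h1 | h1
    · rw [hφ1 s h1.2]; exact one_pos
    · rw [hφF s h1, hh₁d s h1]
      exact div_pos (pow_pos (hh' s h1) 2) (hF s h1)
  · intro s hs
    have : s < c₁ := by linarith [hs.2]
    exact ⟨hφ1 s this, hhf s ⟨hs.1, this⟩⟩
  · intro s hs
    rcases hcover s hs with h1 | h1
    · have hsb : s ∈ Icc a b := ⟨h1.1, h1.2.le.trans hc₁b.le⟩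
      have e1 : derivWithin φ (Ici a) s = 0 := by
        rw [derivWithin_Ici_eq_of_eqOn hc₁b.le (v := fun _ => 1) (fun t ht => hφ1 t ht.2) h1]
        simp
      rw [e1, hφ1 s h1.2, hhf s h1, ← hh₁, hh₁f s h1, derivWithin_Ici_eq_of_eqOn hc₁b.le hh₁f h1]
      exact (hR s hsb).le
    · have hn := hnhds s h1
      have hd : ∀ {u : ℝ → ℝ}, ContDiffOn ℝ ∞ u (Ici a) →
          HasDerivAt u (derivWithin u (Ici a) s) s := fun hu =>
        ((hu.differentiableOn (by simp) s hs).hasDerivWithinAt).hasDerivAt hn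
      have h10 : 0 < h₁ s := by rw [hh₁d s h1]; exact hh' s h1
      -- Past `c₀` the metric is in mass form, so the lower bound is the monotonicity of `μ`.
      rw [warpedScalar_of_mass isOpen_Ioi h1 hφF (hF s h1) (hh0 s hs) h10 (hd hhs) (hd hh₁s)
        (hd hμs) (hd hφs)]
      have h2 := hμ' s h1
      rw [← derivWithin_of_mem_nhds hn] at h2
      have h3 := hh0 s hs
      have : 0 ≤ 4 * derivWithin μ (Ici a) s / (h s ^ 2 * h₁ s) := by positivity
      linarith
  · intro s hs
    have hs' : S < s := hs
    have hsc : s ∈ Ioi c₀ := by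
      change c₀ < s
      linarith
    have e : h₁ s = 1 := by
      rw [hh₁d s hsc]
      have : h =ᶠ[𝓝 s] fun s => s + C := by
        filter_upwards [Ioi_mem_nhds hs'] with t ht using hhS t ht
      rw [this.deriv_eq]
      simp
    rw [hφF s hsc, e, hFd]
    simp only [hhS s hs, hμS s hs, adsCoeff]
    simp
  · intro hpos s hs
    rcases hcover s hs with h1 | h1
    · rw [← hh₁, hh₁f s h1]
      exact hpos s ⟨h1.1, h1.2.le.trans hc₁b.le⟩
    · rw [← hh₁, hh₁d s h1]
      exact hh' s h1

end

end WarpedGluing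

/-! ### The asymptotic end, and proof of the proposition -/

namespace WarpedGluing

theorem Ici_prod_diff_Icc_prod {a S : ℝ} (haS : a ≤ S) :
    (Ici a ×ˢ univ : Set Cyl) \ Icc a S ×ˢ univ = Ioi S ×ˢ univ := by
  ext p
  simp only [mem_sdiff, mem_prod, mem_univ, and_true, mem_Ici, mem_Icc, mem_Ioi]
  constructor
  · rintro ⟨h1, h2⟩
    exact lt_of_not_ge fun h3 => h2 ⟨h1, h3⟩
  · exact fun h => ⟨haS.trans h.le, fun h2 => h.not_ge h2.2⟩

theorem Icc_prod_mem_nhdsWithin {a S : ℝ} (haS : a < S) :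
    ∀ p ∈ ({a} ×ˢ univ : Set Cyl), (Icc a S ×ˢ univ : Set Cyl) ∈ 𝓝[Ici a ×ˢ univ] p := by
  rintro p ⟨hp, -⟩
  have h : Prod.fst ⁻¹' Iio S ∈ 𝓝 p :=
    continuous_fst.continuousAt.preimage_mem_nhds (Iio_mem_nhds (by rw [hp]; exact haS))
  filter_upwards [self_mem_nhdsWithin, mem_nhdsWithin_of_mem_nhds h] with q h1 h2
  exact ⟨⟨h1.1, le_of_lt h2⟩, trivial⟩

/-- The chart at infinity is the shift by `C`, which turns `s` into the area radius `s + C`; the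
push-forward is then the AdS-Schwarzschild metric itself. -/
theorem isAsymptoticallyHyperbolic_warpedMetric {a S C m : ℝ} {φ h : ℝ → ℝ} (haS : a ≤ S)
    (hSC : 2 * |m| + 1 ≤ S + C) (hend : ∀ s ∈ Ioi S, φ s = adsCoeff m (s + C) ∧ h s = s + C) :
    IsAsymptoticallyHyperbolic (warpedMetric φ h) (Ici a ×ˢ univ) := by
  have hm := abs_nonneg m
  have hdiff := Ici_prod_diff_Icc_prod haS
  have hJ : ∀ s, s ∈ Ioi S ↔ s + C ∈ Ioi (S + C) := fun s => by simp
  refine ⟨Icc a S ×ˢ univ, prod_mono Icc_subset_Ici_self subset_rfl,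
    isCompact_Icc.prod isCompact_univ, S + C, by linarith, _, _,
    hdiff ▸ isDiffeo_shiftRotate C (LinearIsometryEquiv.refl ℝ E3) hJ, ?_⟩
  refine isAsymptoticToHyperbolic_of_eq_adsMetric (m := m) (by linarith) (by linarith) fun p hp => ?_
  have hp' : p.1 + -C ∈ Ioi S := by
    have : S + C < p.1 := hp.1
    change S < p.1 + -C
    linarith
  obtain ⟨e1, e2⟩ := hend _ hp'
  rw [neg_add_cancel_right] at e1 e2
  exact pullbackWithin_shiftRotate (uniqueDiffOn_Ioi _) (-C) _ hp.1 e1 e2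

end WarpedGluing

theorem proposition3p3
    (a b : ℝ) (hab : a < b) (f : ℝ → ℝ)
    (hf_smooth : ContDiffOn ℝ ∞ f (Icc a b))
    (hf_pos : ∀ s ∈ Icc a b, 0 < f s)
    (hf_deriv : 0 < derivWithin f (Icc a b) b)
    -- the scalar curvature of the collar exceeds `-6`
    (hR : ∀ p ∈ (Icc a b ×ˢ univ : Set Cyl),
      -6 < scalarCurvature (warpedMetric (fun _ => 1) f) (Icc a b ×ˢ univ) p)
    -- the end sphere has positive mean curvature
    (hH : ∀ θ : S2, 0 < sliceMeanCurvature (warpedMetric (fun _ => 1) f) (Icc a b ×ˢ univ) (b, θ))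
    (hm : -(f b) ^ 3 ≤ sliceHawkingMass (warpedMetric (fun _ => 1) f) (Icc a b ×ˢ univ) b)
    (mₑ : ℝ)
    (hmₑ : sliceHawkingMass (warpedMetric (fun _ => 1) f) (Icc a b ×ˢ univ) b < mₑ) :
    -- the manifold is `M = [a, ∞) × S²`, with inner boundary `{a} × S²`
    ∃ (M bdM : Set Cyl), M = Ici a ×ˢ univ ∧ bdM = {a} ×ˢ univ ∧
    ∃ γ : Tensor2 cylModel Cyl,
      IsRiemannianOn γ M ∧
      IsRotationallySymmetric γ M ∧
      IsAsymptoticallyHyperbolic γ M ∧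
      (∀ p ∈ M, -6 ≤ scalarCurvature γ M p) ∧
      -- AdS-Schwarzschild of mass `mₑ` outside a compact neighbourhood of the inner boundary
      (∃ K ⊆ M, IsCompact K ∧ (∀ p ∈ bdM, K ∈ 𝓝[M] p) ∧
        ∃ r₀ : ℝ, horizonRadius mₑ < r₀ ∧
        ∃ Φ : Cyl → Cyl, IsIsometry γ (M \ K) (adsMetric mₑ) (Ioi r₀ ×ˢ univ) Φ) ∧
      -- a neighbourhood of the inner boundary is isometric to half of the collar
      (∃ N ⊆ M, (∀ p ∈ bdM, N ∈ 𝓝[M] p) ∧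
        ∃ Φ : Cyl → Cyl,
          IsIsometry (warpedMetric (fun _ => 1) f) (Icc a ((a + b) / 2) ×ˢ univ) γ N Φ ∧
          Φ '' ({a} ×ˢ univ) = bdM) ∧
      -- the spheres `{s} × S²`, which foliate `M`, have positive constant mean curvature
      ((∀ s ∈ Icc a b, 0 < derivWithin f (Icc a b) s) →
        ∀ s, a ≤ s → ∃ c : ℝ, 0 < c ∧ ∀ θ : S2, sliceMeanCurvature γ M (s, θ) = c) := by
  have hu := uniqueDiffOn_Icc hab
  set f₁ := derivWithin f (Icc a b) with hf₁
  have hf₁s : ContDiffOn ℝ ∞ f₁ (Icc a b) := hf_smooth.derivWithin hu (by simp)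
  have hdf : ∀ s ∈ Icc a b, HasDerivWithinAt f (f₁ s) (Icc a b) s := fun s hs =>
    (hf_smooth.differentiableOn (by simp) s hs).hasDerivWithinAt
  have hdf₁ : ∀ s ∈ Icc a b, HasDerivWithinAt f₁ (derivWithin f₁ (Icc a b) s) (Icc a b) s :=
    fun s hs => (hf₁s.differentiableOn (by simp) s hs).hasDerivWithinAt
  rw [sliceHawkingMass_warped hu hf_pos hdf (right_mem_Icc.2 hab.le)] at hmₑ
  have hR' : ∀ s ∈ Icc a b, -6 < warpedScalar 1 0 (f s) (f₁ s) (derivWithin f₁ (Icc a b) s) := by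
    intro s hs
    -- The scalar curvature does not depend on the point of the sphere, so one point suffices.
    obtain ⟨θ⟩ : Nonempty S2 := (NormedSpace.sphere_nonempty.2 zero_le_one).to_subtype
    have h := hR (s, θ) ⟨hs, trivial⟩
    rwa [scalarCurvature_warped hu (φ := fun _ => 1) (φ' := fun _ => 0) (fun _ _ => one_pos)
      hf_pos (fun s _ => hasDerivWithinAt_const s _ 1) hdf (fun _ _ => rfl) (p := (s, θ)) hs
      (hasDerivWithinAt_const s _ 0) (hdf₁ s hs)] at h
  obtain ⟨S, C, φ, h, haS, hSC, hφs, hhs, hφ0, hh0, hcollar, hscal, hend, hpos⟩ :=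
    exists_profile hab hf_smooth hf_pos hf_deriv hR' hmₑ
  have hua := uniqueDiffOn_Ici a
  have hdiff : ∀ {u : ℝ → ℝ}, ContDiffOn ℝ ∞ u (Ici a) →
      ∀ s ∈ Ici a, HasDerivWithinAt u (derivWithin u (Ici a) s) (Ici a) s := fun hu s hs =>
    (hu.differentiableOn (by simp) s hs).hasDerivWithinAt
  have hmid : a < (a + b) / 2 := by linarith
  refine ⟨_, _, rfl, rfl, warpedMetric φ h, isRiemannianOn_warpedMetric hφ0 hh0 hφs hhs,
    isRotationallySymmetric_warpedMetric hua φ h,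
    isAsymptoticallyHyperbolic_warpedMetric haS.le hSC hend, ?_, ?_, ?_, ?_⟩
  · intro p hp
    rw [scalarCurvature_warped hua hφ0 hh0 (hdiff hφs) (hdiff hhs) (fun _ _ => rfl) hp.1
      (hdiff (hφs.derivWithin hua (by simp)) _ hp.1) (hdiff (hhs.derivWithin hua (by simp)) _ hp.1)]
    exact hscal _ hp.1
  · refine ⟨Icc a S ×ˢ univ, prod_mono Icc_subset_Ici_self subset_rfl,
      isCompact_Icc.prod isCompact_univ, Icc_prod_mem_nhdsWithin haS, S + C,
      (horizonRadius_le mₑ).trans_lt (by linarith), shiftRotate C (.refl ℝ E3), ?_⟩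
    rw [Ici_prod_diff_Icc_prod haS.le]
    exact isIsometry_shiftRotate (uniqueDiffOn_Ioi S) C _ (fun s => by simp)
      (fun s hs => (hend s hs).1.symm) (fun s hs => (hend s hs).2.symm)
  · refine ⟨Icc a ((a + b) / 2) ×ˢ univ, prod_mono Icc_subset_Ici_self subset_rfl,
      Icc_prod_mem_nhdsWithin hmid, shiftRotate 0 (.refl ℝ E3), ?_, ?_⟩
    · refine isIsometry_shiftRotate (uniqueDiffOn_Icc hmid) 0 _ (fun s => by simp)
        (fun s hs => ?_) (fun s hs => ?_)
      · rw [add_zero, (hcollar s hs).1]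
      · rw [add_zero, (hcollar s hs).2]
    · have e : shiftRotate 0 (.refl ℝ E3) = id := by
        funext p
        simp [shiftRotate, rotate]
      rw [e, image_id]
  · intro hf' s hs
    refine ⟨2 * derivWithin h (Ici a) s / (h s * √(φ s)), ?_, fun θ =>
      sliceMeanCurvature_warped hua hφ0 hh0 (hdiff hφs) (hdiff hhs) (fun _ _ => rfl)
        (p := (s, θ)) hs⟩
    have h1 := hpos hf' s hs
    have h2 := hh0 s hs
    have h3 := Real.sqrt_pos.2 (hφ0 s hs)
    positivity
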